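/- **Theorem (Mean-Square-Error Stability).** Consider a network whose agents are divided into $S$ sending sub-networks and $R$ receiving sub-networks, with combination matrix $A=[a_{\ell k}]$ ($a_{\ell k}$ is the weight with which agent $k$ scales data received from agent $\ell$) that is left-stochastic, $a_{\ell k}\ge 0$, $\sum_\ell a_{\ell k}=1$, and, with the sending agents listed first, has the form $$A=\begin{bmatrix}T_{SS}&T_{SR}\\0&T_{RR}\end{bmatrix},\qquad T_{SS}=\mathrm{blockdiag}\{A_1,\dots,A_S\},$$ where $T_{RR}$ is block upper triangular with diagonal blocks $A_{S+1},\dots,A_{S+R}$, one for each receiving sub-network. Each sending sub-network is strongly connected: inside it, paths with nonzero weights link any two distinct agents in both directions, and $a_{kk}>0$ for some agent $k$ of it. In each receiving sub-network, paths with nonzero weights inside it link any two distinct agents in both directions, and at least one of its agents receives data with positive weight from an agent outside that sub-network. Each agent $k$ has a twice-differentiable convex cost $J_k:\mathbb{R}^M\to\mathbb{R}$ with uniformly bounded Hessian, $\|\nabla^2J_k(w)\|\le\delta$ for all $w$ and $k$, and in each sending sub-network at least one cost is strongly convex. Let the step-sizes be $\mu_k=\tau_k\mu_{\max}$ with $0<\tau_k\le1$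 fixed. On a probability space, the agents run the adapt-then-combine diffusion, for $i\ge1$, $$\boldsymbol\psi_{k,i}=\boldsymbol w_{k,i-1}-\mu_k\,\widehat{\nabla J}_{k,i}(\boldsymbol w_{k,i-1}),\qquad \boldsymbol w_{k,i}=\sum_\ell a_{\ell k}\,\boldsymbol\psi_{\ell,i},$$ from random initial vectors with $\mathbb{E}\|\boldsymbol w_{k,0}\|^2<\infty$, where $\widehat{\nabla J}_{k,i}$ is the (random) approximate gradient used by agent $k$ at time $i$. Let $\boldsymbol{\mathcal F}_{i-1}$ be the $\sigma$-algebra generated by $\{\boldsymbol w_{\ell,j}:j\le i-1\}$ over all agents $\ell$. Assume that the gradient noise $\boldsymbol s_{k,i}=\widehat{\nabla J}_{k,i}(\boldsymbol w_{k,i-1})-\nabla J_k(\boldsymbol w_{k,i-1})$ satisfies, almost surely, for all $k$ and $i\ge1$, $$\mathbb{E}[\boldsymbol s_{k,i}\mid\boldsymbol{\mathcal F}_{i-1}]=0,\qquad \mathbb{E}[\|\boldsymbol s_{k,i}\|^2\mid\boldsymbol{\mathcal F}_{i-1}]\le\beta_k^2\|\boldsymbol w_{k,i-1}\|^2+\sigma_k^2,$$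 with constants $\beta_k,\sigma_k$ that do not depend on $\mu_{\max}$. Then: 1. Each $A_s$, $1\le s\le S$, has a unique Perron vector $p_s$ (that is, $A_sp_s=p_s$, $\mathbf 1^{\mathsf T}p_s=1$, all entries $p_{s,k}>0$), and $I-T_{RR}$ is invertible. 2. For each $s\le S$ the aggregate cost $\sum_k q_{s,k}J_{s,k}(w)$ of sub-network $s$, with $q_{s,k}=\mu_{s,k}p_{s,k}$, has a unique minimizer $w_s^\star$ (the Pareto solution), which does not depend on $\mu_{\max}>0$. 3. Let $W=T_{SR}(I-T_{RR})^{-1}$ and let $\mathsf{w}^\star$ be the vector over all sending agents whose block at each agent of sub-network $s$ is $w_s^\star$. Put $w_k^\star=w_s^\star$ for an agent $k$ of the sending sub-network $s$, and, for a receiving agent $k$, let $w_k^\star$ be the block at agent $k$ of $(W^{\mathsf T}\otimes I_M)\,\mathsf{w}^\star$. Then, for sufficiently small step-sizes, every agent $k$ satisfies $$\limsup_{i\to\infty}\mathbb{E}\|w_k^\star-\boldsymbol w_{k,i}\|^2=O(\mu_{\max}).$$ That is, there are $\mu_0>0$ and $C$, which depend only on $A$, the costs $J_k$, the bound $\delta$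 and $\{\tau_k,\beta_k,\sigma_k\}$, such that for $0<\mu_{\max}<\mu_0$ the left-hand side is at most $C\mu_{\max}$ for every agent $k$, whatever the probability space, the initial vectors and the approximate gradients are. -/

import Mathlib

open MeasureTheory Filter Set
open scoped ENNReal Gradient BigOperators

namespace WeakNet

/-! ### Networks -/

/-- Agents of the sending sub-networks: agent `⟨s, k⟩` is agent `k` of sub-network `s`. -/
abbrev SAgent {S : ℕ} (NS : Fin S → ℕ) : Type := (s : Fin S) × Fin (NS s)

/-- Agents of the receiving sub-networks. -/
abbrev RAgent {R : ℕ} (NR : Fin R → ℕ) : Type := (r : Fin R) × Fin (NR r)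

/-- All agents: the group `S` agents come first, followed by the group `R` agents. -/
abbrev Agent {S R : ℕ} (NS : Fin S → ℕ) (NR : Fin R → ℕ) : Type := SAgent NS ⊕ RAgent NR

/-- Paths with nonzero scaling weights link any two distinct agents (in both directions, since the
pair is ordered). `B ℓ k` is the weight with which agent `k` scales the data coming from `ℓ`. -/
def IsConnectedNet {n : Type*} (B : Matrix n n ℝ) : Prop :=
  ∀ ℓ k : n, ℓ ≠ k → Relation.TransGen (fun a b => B a b ≠ 0) ℓ k

/-- Connected, with at least one self-loop. -/
def IsStronglyConnectedNet {n : Type*} (B : Matrix n n ℝ) : Prop :=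
  IsConnectedNet B ∧ ∃ k, 0 < B k k

section Blocks

variable {S R : ℕ} {NS : Fin S → ℕ} {NR : Fin R → ℕ}

/-- The internal combination matrix of the sending sub-network `s`. -/
def sendBlock (A : Matrix (Agent NS NR) (Agent NS NR) ℝ) (s : Fin S) :
    Matrix (Fin (NS s)) (Fin (NS s)) ℝ :=
  fun ℓ k => A (Sum.inl ⟨s, ℓ⟩) (Sum.inl ⟨s, k⟩)

/-- The internal combination matrix of the receiving sub-network `r`. -/
def recvBlock (A : Matrix (Agent NS NR) (Agent NS NR) ℝ) (r : Fin R) :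
    Matrix (Fin (NR r)) (Fin (NR r)) ℝ :=
  fun ℓ k => A (Sum.inr ⟨r, ℓ⟩) (Sum.inr ⟨r, k⟩)

/-- The block of weights from group `S` to group `R`. -/
def TSR (A : Matrix (Agent NS NR) (Agent NS NR) ℝ) : Matrix (SAgent NS) (RAgent NR) ℝ :=
  A.toBlocks₁₂

/-- The block of weights internal to group `R`. -/
def TRR (A : Matrix (Agent NS NR) (Agent NS NR) ℝ) : Matrix (RAgent NR) (RAgent NR) ℝ :=
  A.toBlocks₂₂

/-- `A` is the combination matrix of a weakly-connected network, in its block upper triangular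
form. -/
structure IsWeaklyConnected (A : Matrix (Agent NS NR) (Agent NS NR) ℝ) : Prop where
  nonneg : ∀ ℓ k, 0 ≤ A ℓ k
  /-- `A` is left-stochastic. -/
  colSum : ∀ k, ∑ ℓ, A ℓ k = 1
  /-- Distinct sending sub-networks do not exchange information. -/
  send_send : ∀ ℓ k : SAgent NS, ℓ.1 ≠ k.1 → A (Sum.inl ℓ) (Sum.inl k) = 0
  /-- Sending sub-networks receive nothing from receiving sub-networks. -/
  recv_send : ∀ (ℓ : RAgent NR) (k : SAgent NS), A (Sum.inr ℓ) (Sum.inl k) = 0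
  /-- The block of weights internal to group `R` is block upper triangular. -/
  recv_recv : ∀ ℓ k : RAgent NR, k.1 < ℓ.1 → A (Sum.inr ℓ) (Sum.inr k) = 0
  send_connected : ∀ s, IsStronglyConnectedNet (sendBlock A s)
  recv_connected : ∀ r, IsConnectedNet (recvBlock A r)
  /-- Some agent of each receiving sub-network gets information from outside its sub-network. -/
  receives : ∀ r, ∃ (k : Fin (NR r)) (ℓ : Agent NS NR),
    (∀ j : Fin (NR r), ℓ ≠ Sum.inr ⟨r, j⟩) ∧ 0 < A ℓ (Sum.inr ⟨r, k⟩)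

/-- The matrix `W = T_SR (I - T_RR)⁻¹`. -/
noncomputable def W (A : Matrix (Agent NS NR) (Agent NS NR) ℝ) :
    Matrix (SAgent NS) (RAgent NR) ℝ :=
  TSR A * (1 - TRR A)⁻¹

end Blocks

/-- `p` is the Perron eigenvector of `B`: `B p = p`, entries positive and adding up to one. -/
def IsPerronVector {n : Type*} [Fintype n] (B : Matrix n n ℝ) (p : n → ℝ) : Prop :=
  B.mulVec p = p ∧ ∑ k, p k = 1 ∧ ∀ k, 0 < p k

/-! ### Limit points -/

section Limits

variable {S R M : ℕ} {NS : Fin S → ℕ} {NR : Fin R → ℕ}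

/-- The step-sizes `μ_k = τ_k μ_max`. -/
def stepSize {n : Type*} (τ : n → ℝ) (μmax : ℝ) (k : n) : ℝ := τ k * μmax

/-- The weighted aggregate cost `∑ q_{s,k} J_{s,k}` of the sending sub-network `s`, where
`q_{s,k} = μ_{s,k} p_{s,k}`. -/
noncomputable def aggregateCost (J : Agent NS NR → EuclideanSpace ℝ (Fin M) → ℝ)
    (μ : Agent NS NR → ℝ) (s : Fin S) (p : Fin (NS s) → ℝ) (v : EuclideanSpace ℝ (Fin M)) : ℝ :=
  ∑ k : Fin (NS s), (μ (Sum.inl ⟨s, k⟩) * p k) * J (Sum.inl ⟨s, k⟩) v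

/-- The stacked vector `𝓌⋆` whose block at agent `⟨s, k⟩` is `wS s`. -/
def stackS (NS : Fin S → ℕ) (wS : Fin S → EuclideanSpace ℝ (Fin M)) : SAgent NS × Fin M → ℝ :=
  fun x => wS x.1.1 x.2

/-- The stacked vector `(Wᵀ ⊗ I_M) 𝓌⋆` of limit points of the group `R` agents. -/
noncomputable def stackR (A : Matrix (Agent NS NR) (Agent NS NR) ℝ)
    (wS : Fin S → EuclideanSpace ℝ (Fin M)) : RAgent NR × Fin M → ℝ :=
  (Matrix.kronecker (W A).transpose (1 : Matrix (Fin M) (Fin M) ℝ)).mulVec (stackS NS wS)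

/-- The limit point `w_k⋆` of each agent. -/
noncomputable def limitPoint (A : Matrix (Agent NS NR) (Agent NS NR) ℝ)
    (wS : Fin S → EuclideanSpace ℝ (Fin M)) : Agent NS NR → EuclideanSpace ℝ (Fin M)
  | Sum.inl a => wS a.1
  | Sum.inr a => WithLp.toLp 2 fun m => stackR A wS (a, m)

end Limits

/-! ### The ATC diffusion strategy -/

section Diffusion

variable {n E Ω : Type*} [Fintype n] [NormedAddCommGroup E] [InnerProductSpace ℝ E]

/-- Adaptation step `ψ_k = w_k - μ_k ĝ_k(w_k)`. -/
def adapt (μ : n → ℝ) (g : n → E → Ω → E) (w : n → Ω → E) (k : n) (ω : Ω) : E :=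
  w k ω - μ k • g k (w k ω) ω

/-- The adapt-then-combine iterates, started at `w0` at time `0`; `gHat k i` is the random map used
by agent `k` at time `i ≥ 1` as an approximation of the gradient of its cost. -/
def iterate (A : Matrix n n ℝ) (μ : n → ℝ) (gHat : n → ℕ → E → Ω → E) (w0 : n → Ω → E) :
    ℕ → n → Ω → E
  | 0 => w0
  | i + 1 => fun k ω =>
      ∑ ℓ, A ℓ k • adapt μ (fun j => gHat j (i + 1)) (iterate A μ gHat w0 i) ℓ ω

/-- The events generated by all iterates, across all agents, up to time `i`. -/
@[reducible] def pastEvents [MeasurableSpace E] (w : ℕ → n → Ω → E) (i : ℕ) : MeasurableSpace Ω :=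
  ⨆ j : Fin (i + 1), ⨆ k : n, MeasurableSpace.comap (w j k) inferInstance

/-- The gradient noise: approximate gradient minus true gradient. -/
noncomputable def gradientNoise [CompleteSpace E] (J : n → E → ℝ) (gHat : n → ℕ → E → Ω → E)
    (k : n) (i : ℕ) (v : E) (ω : Ω) : E :=
  gHat k i v ω - ∇ (J k) v

/-- First- and second-order conditional moment conditions on the gradient noise along the
iterates `w`. -/
structure NoiseConditions [CompleteSpace E] [MeasurableSpace E] [MeasurableSpace Ω]
    (P : Measure Ω) (J : n → E → ℝ) (gHat : n → ℕ → E → Ω → E) (w : ℕ → n → Ω → E)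
    (β σ : n → ℝ) : Prop where
  /-- The approximate gradients that the agents use are random vectors. -/
  measurable : ∀ k i, Measurable fun ω => gHat k (i + 1) (w i k ω) ω
  zero_mean : ∀ k i,
    condExp (pastEvents w i) P (fun ω => gradientNoise J gHat k (i + 1) (w i k ω) ω) =ᵐ[P] 0
  second_moment : ∀ k i,
    condLExp (pastEvents w i) P (fun ω => ‖gradientNoise J gHat k (i + 1) (w i k ω) ω‖ₑ ^ 2)
      ≤ᵐ[P] fun ω => ENNReal.ofReal (β k ^ 2 * ‖w i k ω‖ ^ 2 + σ k ^ 2)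

end Diffusion

end WeakNet

/-!
# Mean-square-error stability of diffusion over weakly-connected networks

The errors `x = w - w⋆` of all agents are stacked in one vector. The combination step then acts as
the linear map `combine A`, that is `Aᵀ ⊗ I`, and the argument is a Lyapunov argument for the whole
network at once, sending and receiving agents together.

*The combination step.* It preserves the Perron-weighted `centroid` of each sending sub-network
(`IsWeaklyConnected.centroid_combine`), and it fixes the vectors `spread A c`, in which every
sending agent holds the value `c s` of its sub-network and the receiving agents mix these values
with the weights `W = T_SR (I - T_RR)⁻¹` (`IsWeaklyConnected.combine_spread`). The limit points are
such a vector (`limitPoint_eq_spread`). A self-loop makes each sending block primitive, and every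
receiving agent is reached from some sending agent; so, for some `m`, every column of `A ^ m`
dominates a multiple of the Perron vector of some sending sub-network
(`IsWeaklyConnected.exists_minorization`). Hence `combine A ^ m` contracts the vectors with zero
centroids (`IsWeaklyConnected.exists_norm_combine_pow_le`). This also gives the invertibility of
`I - T_RR`, and a quadratic form `Q`, equivalent to the squared norm, that `combine A` itself
decreases on these vectors (`exists_lyapunov_form`).

*The noiseless recursion.* Write `x = spread A c + d` with `c` the centroids of `x`. Up to a
perturbation of size `μ ‖d‖`, each centroid makes a gradient step on its aggregate cost, whose
gradient is Lipschitz and strongly monotone, so that `‖c s‖ ^ 2` is contracted by a factor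
`1 - a μ`. The deviation `d` is contracted in `Q` by a factor that does not depend on `μ`, with a
forcing of order `μ ^ 2`. So `V = ∑ s, ‖c s‖ ^ 2 + Q d` decreases by a factor `1 - r μ`, up to a
term `K μ ^ 2`, for small `μ` (`IsWeaklyConnected.exists_lyapunov_meanStep`).

*The noise.* As `V` is a quadratic form and the noise is centered given the past, the noise enters
`E V` only through its second moment, which is of order `μ ^ 2 (1 + E V)`
(`integral_quadratic_succ_le`). The resulting scalar recursion settles at a value of order
`μ ^ 2 / μ = μ` (`limsup_le_of_recursion`).
-/

namespace WeakNet

/-! ### Strongly convex functions and their gradients -/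

section Convex

variable {E : Type*} [NormedAddCommGroup E] [InnerProductSpace ℝ E]

/-- First-order characterisation of strong convexity; `ν = 0` is the convex case. -/
theorem support_of_strongConvexOn [CompleteSpace E] {f : E → ℝ} {ν : ℝ}
    (hf : StrongConvexOn univ ν f) (hd : Differentiable ℝ f) (x y : E) :
    f y + inner ℝ (∇ f y) (x - y) + ν / 2 * ‖x - y‖ ^ 2 ≤ f x := by
  have hline : HasDerivAt (fun t : ℝ => f (y + t • (x - y))) (inner ℝ (∇ f y) (x - y)) 0 := by
    have h1 : HasFDerivAt f (fderiv ℝ f y) (y + (0 : ℝ) • (x - y)) := by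
      simpa using (hd y).hasFDerivAt
    have h2 : HasDerivAt (fun t : ℝ => y + t • (x - y)) (x - y) 0 := by
      simpa using ((hasDerivAt_id (0 : ℝ)).smul_const (x - y)).const_add y
    rw [inner_gradient_left]
    exact h1.comp_hasDerivAt 0 h2
  have hl := hline.tendsto_slope_zero_right
  have hr : Tendsto (fun t : ℝ => f x - f y - (1 - t) * (ν / 2 * ‖x - y‖ ^ 2))
      (nhdsWithin 0 (Ioi 0)) (nhds (f x - f y - (1 - 0) * (ν / 2 * ‖x - y‖ ^ 2))) :=
    (Continuous.tendsto (by fun_prop) 0).mono_left nhdsWithin_le_nhds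
  have hle := le_of_tendsto_of_tendsto hl hr (by
    filter_upwards [Ioo_mem_nhdsGT (show (0 : ℝ) < 1 by norm_num)] with t ht
    have hc := hf.2 (mem_univ y) (mem_univ x) (sub_nonneg.2 ht.2.le) ht.1.le (by ring)
    have he : (1 - t) • y + t • x = y + t • (x - y) := by module
    simp only [he, smul_eq_mul, norm_sub_rev y x, zero_add, zero_smul, add_zero] at hc ⊢
    rw [inv_mul_le_iff₀ ht.1]
    linear_combination hc)
  linarith

/-- A vector field `G` that supports `F` with modulus `a > 0` and vanishes at the minimizers
of `F` has a zero, which is the unique minimizer of `F`. -/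
theorem exists_unique_isMinOn_of_support [FiniteDimensional ℝ E] {F : E → ℝ} {G : E → E} {a : ℝ}
    (hF : Continuous F) (ha : 0 < a)
    (h : ∀ x y, F y + inner ℝ (G y) (x - y) + a / 2 * ‖x - y‖ ^ 2 ≤ F x)
    (hG : ∀ v, IsMinOn F univ v → G v = 0) :
    ∃ v₀, G v₀ = 0 ∧ ∀ v, IsMinOn F univ v ↔ v = v₀ := by
  have hco : Tendsto F (cocompact E) atTop := by
    have hquad : Tendsto (fun r : ℝ => r * (a / 2 * r - ‖G 0‖) + F 0) atTop atTop := by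
      refine tendsto_atTop_add_const_right _ _ (tendsto_id.atTop_mul_atTop₀ ?_)
      exact tendsto_atTop_add_const_right _ _ (tendsto_id.const_mul_atTop (by positivity))
    refine tendsto_atTop_mono (fun x => ?_) (hquad.comp (tendsto_norm_cocompact_atTop (E := E)))
    have h1 := h x 0
    have h2 := neg_le_of_abs_le (abs_real_inner_le_norm (G 0) (x - 0))
    simp only [sub_zero, Function.comp_apply] at *
    linarith
  obtain ⟨v₀, hv₀⟩ := hF.exists_forall_le hco
  have hmin : IsMinOn F univ v₀ := fun x _ => hv₀ x
  have hz := hG v₀ hmin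
  refine ⟨v₀, hz, fun v => ⟨fun hv => ?_, fun hv => hv ▸ hmin⟩⟩
  have h1 := h v v₀
  have h2 : F v ≤ F v₀ := hv (mem_univ _)
  rw [hz, inner_zero_left] at h1
  have h3 : ‖v - v₀‖ ^ 2 ≤ 0 := by
    by_contra hcon
    have : 0 < a / 2 * ‖v - v₀‖ ^ 2 := by
      push Not at hcon
      positivity
    linarith
  have h4 : ‖v - v₀‖ = 0 := by nlinarith [norm_nonneg (v - v₀)]
  exact sub_eq_zero.1 (norm_eq_zero.1 h4)

/-- A weighted sum of convex differentiable functions, one of them strongly convex and with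
positive weight, has the weighted sum of the gradients as a supporting vector field. -/
theorem exists_sum_support [CompleteSpace E] {ι : Type*} [Fintype ι] {f : ι → E → ℝ} {q : ι → ℝ}
    (hd : ∀ k, Differentiable ℝ (f k)) (hc : ∀ k, ConvexOn ℝ univ (f k)) (hq : ∀ k, 0 < q k)
    (hs : ∃ k, ∃ ν : ℝ, 0 < ν ∧ StrongConvexOn univ ν (f k)) :
    ∃ a : ℝ, 0 < a ∧ ∀ x y, ∑ k, q k * f k y + inner ℝ (∑ k, q k • ∇ (f k) y) (x - y)
      + a / 2 * ‖x - y‖ ^ 2 ≤ ∑ k, q k * f k x := by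
  classical
  obtain ⟨k₀, ν, hν, hsc⟩ := hs
  refine ⟨q k₀ * ν, mul_pos (hq k₀) hν, fun x y => ?_⟩
  have hk : ∀ k, q k * f k y + inner ℝ (q k • ∇ (f k) y) (x - y)
      + (if k = k₀ then q k₀ * ν / 2 * ‖x - y‖ ^ 2 else 0) ≤ q k * f k x := by
    intro k
    rw [real_inner_smul_left]
    split_ifs with hk
    · subst hk
      have := mul_le_mul_of_nonneg_left (support_of_strongConvexOn hsc (hd k) x y) (hq k).le
      linarith
    · have := mul_le_mul_of_nonneg_left
        (support_of_strongConvexOn (strongConvexOn_zero.2 (hc k)) (hd k) x y) (hq k).le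
      linarith
  have := Finset.sum_le_sum fun k (_ : k ∈ Finset.univ) => hk k
  simpa [Finset.sum_add_distrib, sum_inner] using this

theorem sum_smul_gradient_eq_zero_of_isMinOn [CompleteSpace E] {ι : Type*} [Fintype ι]
    {f : ι → E → ℝ} {q : ι → ℝ} (hd : ∀ k, Differentiable ℝ (f k)) {v : E}
    (hv : IsMinOn (fun x => ∑ k, q k * f k x) univ v) : ∑ k, q k • ∇ (f k) v = 0 := by
  have hF : HasFDerivAt (fun x => ∑ k, q k * f k x) (∑ k, q k • fderiv ℝ (f k) v) v :=
    HasFDerivAt.fun_sum fun k _ => (hd k v).hasFDerivAt.const_mul (q k)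
  have h0 := (hv.isLocalMin univ_mem).hasFDerivAt_eq_zero hF
  refine ext_inner_right ℝ fun y => ?_
  have := congrArg (fun L : E →L[ℝ] ℝ => L y) h0
  simpa [sum_inner, real_inner_smul_left, inner_gradient_left] using this

/-- Monotonicity of a supporting vector field. -/
theorem inner_sub_ge_of_support {F : E → ℝ} {G : E → E} {a : ℝ}
    (h : ∀ x y, F y + inner ℝ (G y) (x - y) + a / 2 * ‖x - y‖ ^ 2 ≤ F x) (x y : E) :
    a * ‖x - y‖ ^ 2 ≤ inner ℝ (G x - G y) (x - y) := by
  have h1 := h x y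
  have h2 := h y x
  rw [← neg_sub x y, inner_neg_right, norm_neg] at h2
  rw [inner_sub_left]
  linarith

end Convex

/-! ### Perron vectors of connected stochastic matrices -/

section Perron

variable {n : Type*} [Fintype n] {B : Matrix n n ℝ}

/-- A nonnegative fixed vector is zero or positive: a zero entry propagates along the paths. -/
theorem eq_zero_of_mulVec_eq_self (hB : ∀ i j, 0 ≤ B i j) (hc : IsConnectedNet B) {r : n → ℝ}
    (hr : ∀ i, 0 ≤ r i) (hfix : B.mulVec r = r) {a : n} (ha : r a = 0) : r = 0 := by
  have step : ∀ a b, r a = 0 → B a b ≠ 0 → r b = 0 := by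
    intro a b ha hab
    have h0 : ∑ j, B a j * r j = 0 := by
      have := congrFun hfix a
      rwa [ha] at this
    have := (Finset.sum_eq_zero_iff_of_nonneg fun j _ => mul_nonneg (hB a j) (hr j)).1 h0 b
      (Finset.mem_univ b)
    exact (mul_eq_zero.1 this).resolve_left hab
  funext b
  by_cases hab : a = b
  · rw [← hab, ha, Pi.zero_apply]
  · have hp := hc a b hab
    clear hab
    induction hp with
    | single h => exact step _ _ ha h
    | tail _ h ih => exact step _ _ ih h

/-- A real fixed vector `v` of a nonnegative column-stochastic matrix has a fixed absolute value:
`|v| ≤ B |v|` entrywise, and both sides have the same sum. -/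
theorem mulVec_abs_eq (hB : ∀ i j, 0 ≤ B i j) (hsum : ∀ j, ∑ i, B i j = 1) {v : n → ℝ}
    (hv : B.mulVec v = v) : B.mulVec (fun i => |v i|) = fun i => |v i| := by
  have hle : ∀ i, |v i| ≤ B.mulVec (fun i => |v i|) i := by
    intro i
    calc |v i| = |∑ j, B i j * v j| := by
          conv_lhs => rw [← hv]
          rfl
      _ ≤ ∑ j, |B i j * v j| := Finset.abs_sum_le_sum_abs _ _
      _ = ∑ j, B i j * |v j| := by simp only [abs_mul, abs_of_nonneg (hB i _)]
  have htot : ∑ i, B.mulVec (fun i => |v i|) i = ∑ i, |v i| := by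
    simp only [Matrix.mulVec, dotProduct]
    rw [Finset.sum_comm]
    simp [← Finset.sum_mul, hsum]
  have := (Finset.sum_eq_sum_iff_of_le fun i _ => hle i).1 htot.symm
  exact (funext fun i => this i (Finset.mem_univ i)).symm

/-- Since the columns add up to one, `B - 1` is singular, so `B` has a real fixed vector; its
absolute value, normalized, is a Perron vector. -/
theorem existsUnique_isPerronVector [Nonempty n] (hB : ∀ i j, 0 ≤ B i j)
    (hsum : ∀ j, ∑ i, B i j = 1) (hc : IsConnectedNet B) : ∃! p, IsPerronVector B p := by
  classical
  obtain ⟨v, hv0, hv⟩ : ∃ v : n → ℝ, v ≠ 0 ∧ (B - 1).mulVec v = 0 := by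
    rw [Matrix.exists_mulVec_eq_zero_iff, ← Matrix.exists_vecMul_eq_zero_iff]
    refine ⟨fun _ => 1, fun h => one_ne_zero (congrFun h (Classical.arbitrary n)), ?_⟩
    funext j
    simp [Matrix.vecMul, dotProduct, Matrix.sub_apply, Finset.sum_sub_distrib, hsum,
      Matrix.one_apply]
  have hv1 : B.mulVec v = v := by
    rw [Matrix.sub_mulVec, Matrix.one_mulVec] at hv
    exact sub_eq_zero.1 hv
  have habs := mulVec_abs_eq hB hsum hv1
  have hpos : ∀ k, 0 < |v k| := by
    intro k
    refine lt_of_le_of_ne (abs_nonneg _) fun hk => hv0 ?_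
    have := eq_zero_of_mulVec_eq_self hB hc (fun i => abs_nonneg (v i)) habs hk.symm
    funext i
    exact abs_eq_zero.1 (congrFun this i)
  have hS : 0 < ∑ k, |v k| := Finset.sum_pos (fun k _ => hpos k) Finset.univ_nonempty
  have hP : IsPerronVector B ((∑ k, |v k|)⁻¹ • fun k => |v k|) := by
    refine ⟨by rw [Matrix.mulVec_smul, habs], ?_, fun k => ?_⟩
    · simp only [Pi.smul_apply, smul_eq_mul, ← Finset.mul_sum]
      exact inv_mul_cancel₀ hS.ne'
    · exact mul_pos (inv_pos.2 hS) (hpos k)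
  suffices huniq : ∀ p q, IsPerronVector B p → IsPerronVector B q → ∀ k, p k ≤ q k from
    ⟨_, hP, fun q hq => funext fun k => le_antisymm (huniq _ _ hq hP k) (huniq _ _ hP hq k)⟩
  intro p q hp hq
  -- The positive part of `p - q` is a fixed vector, and it has a zero entry since `p` and `q`
  -- have the same sum; so it vanishes.
  have hd : B.mulVec (p - q) = p - q := by rw [Matrix.mulVec_sub, hp.1, hq.1]
  have hplus : B.mulVec (fun i => |(p - q) i| + (p - q) i) =
      fun i => |(p - q) i| + (p - q) i := by
    have h := Matrix.mulVec_add B (fun i => |(p - q) i|) (p - q)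
    rw [mulVec_abs_eq hB hsum hd, hd] at h
    exact h
  obtain ⟨a, ha⟩ : ∃ a, p a ≤ q a := by
    by_contra! hcon
    have := Finset.sum_lt_sum_of_nonempty (Finset.univ_nonempty (α := n)) fun k _ => hcon k
    rw [hp.2.1, hq.2.1] at this
    exact lt_irrefl _ this
  have hz := eq_zero_of_mulVec_eq_self hB hc
    (fun i => by linarith [neg_abs_le ((p - q) i)]) hplus (a := a) (by
      rw [abs_of_nonpos (by simpa using ha)]
      ring)
  intro k
  have := congrFun hz k
  simp only [Pi.sub_apply, Pi.zero_apply] at this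
  linarith [abs_nonneg (p k - q k)]

end Perron

/-! ### Positivity of powers of the combination matrix -/

section Positivity

variable {n : Type*} [Fintype n] [DecidableEq n] {A : Matrix n n ℝ}

theorem pow_apply_nonneg (hA : ∀ i j, 0 ≤ A i j) (m : ℕ) (i j : n) : 0 ≤ (A ^ m) i j := by
  induction m generalizing i j with
  | zero => rw [pow_zero, Matrix.one_apply]; split_ifs <;> norm_num
  | succ m ih =>
    rw [pow_succ, Matrix.mul_apply]
    exact Finset.sum_nonneg fun l _ => mul_nonneg (ih i l) (hA l j)

theorem pow_add_apply_pos (hA : ∀ i j, 0 ≤ A i j) {m m' : ℕ} {i j k : n}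
    (h1 : 0 < (A ^ m) i j) (h2 : 0 < (A ^ m') j k) : 0 < (A ^ (m + m')) i k := by
  rw [pow_add, Matrix.mul_apply]
  exact Finset.sum_pos' (fun l _ => mul_nonneg (pow_apply_nonneg hA m i l)
    (pow_apply_nonneg hA m' l k)) ⟨j, Finset.mem_univ j, mul_pos h1 h2⟩

/-- A path that stays in the image of `f` yields a positive entry of a power of the matrix. -/
theorem exists_pow_pos_of_transGen (hA : ∀ i j, 0 ≤ A i j) {ι : Type*} (f : ι → n) {a b : ι}
    (h : Relation.TransGen (fun x y => A (f x) (f y) ≠ 0) a b) :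
    ∃ m, 0 < (A ^ m) (f a) (f b) := by
  have hstep : ∀ x y, A (f x) (f y) ≠ 0 → 0 < (A ^ 1) (f x) (f y) := fun x y hxy => by
    rw [pow_one]
    exact lt_of_le_of_ne (hA _ _) hxy.symm
  induction h with
  | single h => exact ⟨1, hstep _ _ h⟩
  | tail _ h ih =>
    obtain ⟨m, hm⟩ := ih
    exact ⟨m + 1, pow_add_apply_pos hA hm (hstep _ _ h)⟩

theorem exists_pow_pos_of_isConnectedNet (hA : ∀ i j, 0 ≤ A i j) {ι : Type*} (f : ι → n)
    (hc : IsConnectedNet fun x y => A (f x) (f y)) (a b : ι) : ∃ m, 0 < (A ^ m) (f a) (f b) := by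
  by_cases hab : a = b
  · exact ⟨0, by simp [hab]⟩
  · exact exists_pow_pos_of_transGen hA f (hc a b hab)

/-- A connected block with a self-loop is primitive: the self-loop absorbs any excess length. -/
theorem eventually_pow_pos_of_isStronglyConnectedNet (hA : ∀ i j, 0 ≤ A i j) {ι : Type*}
    (f : ι → n) (hc : IsStronglyConnectedNet fun x y => A (f x) (f y)) (a b : ι) :
    ∀ᶠ m in atTop, 0 < (A ^ m) (f a) (f b) := by
  obtain ⟨hc, k, hk⟩ := hc
  obtain ⟨m₁, h₁⟩ := exists_pow_pos_of_isConnectedNet hA f hc a k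
  obtain ⟨m₂, h₂⟩ := exists_pow_pos_of_isConnectedNet hA f hc k b
  have hloop : ∀ j, 0 < (A ^ j) (f k) (f k) := by
    intro j
    induction j with
    | zero => simp
    | succ j ih => exact pow_add_apply_pos hA ih (by rwa [pow_one])
  filter_upwards [eventually_ge_atTop (m₁ + m₂)] with m hm
  obtain ⟨j, rfl⟩ := Nat.exists_eq_add_of_le hm
  have := pow_add_apply_pos hA (pow_add_apply_pos hA h₁ (hloop j)) h₂
  rwa [show m₁ + m₂ + j = m₁ + j + m₂ by ring]

end Positivity

section Network

variable {S R : ℕ} {NS : Fin S → ℕ} {NR : Fin R → ℕ} {A : Matrix (Agent NS NR) (Agent NS NR) ℝ}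

/-- Every receiving agent is reached from some sending agent: follow the link that enters its
sub-network from outside, which starts at a sending agent or in an earlier sub-network. -/
theorem IsWeaklyConnected.exists_pow_pos_send_recv (hA : IsWeaklyConnected A) (r : Fin R) :
    ∀ k : Fin (NR r), ∃ (a : SAgent NS) (m : ℕ), 0 < (A ^ m) (Sum.inl a) (Sum.inr ⟨r, k⟩) := by
  induction r using WellFoundedLT.induction with
  | ind r ih =>
    intro k
    obtain ⟨k₀, ℓ, hℓ, hpos⟩ := hA.receives r
    obtain ⟨m, hm⟩ := exists_pow_pos_of_isConnectedNet hA.nonneg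
      (fun j : Fin (NR r) => (Sum.inr ⟨r, j⟩ : Agent NS NR)) (hA.recv_connected r) k₀ k
    rw [← pow_one A] at hpos
    have hm := pow_add_apply_pos hA.nonneg hpos hm
    rcases ℓ with a | ⟨r', j⟩
    · exact ⟨a, _, hm⟩
    · have hrr : r' < r := by
        rcases lt_trichotomy r' r with h | h | h
        · exact h
        · subst h
          exact absurd rfl (hℓ j)
        · rw [pow_one, hA.recv_recv ⟨r', j⟩ ⟨r, k₀⟩ h] at hpos
          exact absurd hpos (lt_irrefl _)
      obtain ⟨a, m', hm'⟩ := ih r' hrr j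
      exact ⟨a, _, pow_add_apply_pos hA.nonneg hm' hm⟩

/-- Doeblin-type condition: after some number of steps, the data of every agent contain a positive
proportion of the data of all agents of some sending sub-network. -/
theorem IsWeaklyConnected.exists_minorization (hA : IsWeaklyConnected A)
    (p : (s : Fin S) → Fin (NS s) → ℝ) :
    ∃ (m : ℕ) (η : ℝ), 0 < η ∧ η ≤ 1 ∧
      ∀ k, ∃ s, ∀ ℓ, η * p s ℓ ≤ (A ^ m) (Sum.inl ⟨s, ℓ⟩) k := by
  have hsend : ∀ s (ℓ j : Fin (NS s)),
      ∀ᶠ m in atTop, 0 < (A ^ m) (Sum.inl ⟨s, ℓ⟩) (Sum.inl ⟨s, j⟩) := fun s =>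
    eventually_pow_pos_of_isStronglyConnectedNet hA.nonneg
      (fun j : Fin (NS s) => (Sum.inl ⟨s, j⟩ : Agent NS NR)) (hA.send_connected s)
  have hall : ∀ k, ∃ s, ∀ ℓ, ∀ᶠ m in atTop, 0 < (A ^ m) (Sum.inl ⟨s, ℓ⟩) k := by
    rintro (⟨s, j⟩ | ⟨r, j⟩)
    · exact ⟨s, fun ℓ => hsend s ℓ j⟩
    · obtain ⟨⟨s, a⟩, m', hm'⟩ := hA.exists_pow_pos_send_recv r j
      refine ⟨s, fun ℓ => ?_⟩
      have := (tendsto_sub_atTop_nat m').eventually (hsend s ℓ a)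
      filter_upwards [this, eventually_ge_atTop m'] with m hm hle
      have := pow_add_apply_pos hA.nonneg hm hm'
      rwa [Nat.sub_add_cancel hle] at this
  choose s hs using hall
  have hm : ∀ᶠ m in atTop, ∀ k, ∀ ℓ, 0 < (A ^ m) (Sum.inl ⟨s k, ℓ⟩) k :=
    eventually_all.2 fun k => eventually_all.2 fun ℓ => hs k ℓ
  obtain ⟨m, hm⟩ := hm.exists
  have hη : ∀ᶠ η : ℝ in nhdsWithin 0 (Ioi 0),
      ∀ k, ∀ ℓ, η * p (s k) ℓ ≤ (A ^ m) (Sum.inl ⟨s k, ℓ⟩) k := by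
    refine eventually_all.2 fun k => eventually_all.2 fun ℓ => ?_
    have ht : Tendsto (fun η : ℝ => η * p (s k) ℓ) (nhdsWithin 0 (Ioi 0)) (nhds (0 * p (s k) ℓ)) :=
      (Continuous.tendsto (by fun_prop) 0).mono_left nhdsWithin_le_nhds
    rw [zero_mul] at ht
    exact ht.eventually_le_const (hm k ℓ)
  obtain ⟨η, hη, h0, h1⟩ := (hη.and (Ioo_mem_nhdsGT (show (0 : ℝ) < 1 by norm_num))).exists
  exact ⟨m, η, h0, h1.le, fun k => ⟨s k, hη k⟩⟩

theorem IsWeaklyConnected.existsUnique_perron (hA : IsWeaklyConnected A) (s : Fin S) :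
    ∃! p, IsPerronVector (sendBlock A s) p := by
  obtain ⟨hc, k, -⟩ := hA.send_connected s
  have : Nonempty (Fin (NS s)) := ⟨k⟩
  refine existsUnique_isPerronVector (fun i j => hA.nonneg _ _) (fun j => ?_) hc
  rw [← hA.colSum (Sum.inl ⟨s, j⟩), Fintype.sum_sum_type,
    Finset.sum_eq_zero fun a _ => hA.recv_send a ⟨s, j⟩, add_zero, Fintype.sum_sigma,
    Finset.sum_eq_single s]
  · rfl
  · intro s' _ hs'
    exact Finset.sum_eq_zero fun i _ => hA.send_send ⟨s', i⟩ ⟨s, j⟩ hs'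
  · simp

end Network

/-! ### The combination step as a linear map -/

section Combine

variable {n E : Type*} [Fintype n] [NormedAddCommGroup E] [NormedSpace ℝ E]

/-- The combination step `(x_ℓ) ↦ (∑ ℓ, a_{ℓk} x_ℓ)_k`, that is `Aᵀ ⊗ I`, on stacked vectors. These
carry the supremum norm, for which the step is nonexpansive when `A` is left-stochastic. -/
noncomputable def combine (A : Matrix n n ℝ) : (n → E) →L[ℝ] (n → E) :=
  ContinuousLinearMap.pi fun k => ∑ ℓ, A ℓ k • ContinuousLinearMap.proj ℓ

theorem combine_apply (A : Matrix n n ℝ) (x : n → E) (k : n) :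
    combine A x k = ∑ ℓ, A ℓ k • x ℓ := by
  simp [combine]

theorem combine_pow [DecidableEq n] (A : Matrix n n ℝ) (m : ℕ) :
    combine (E := E) (A ^ m) = combine A ^ m := by
  induction m with
  | zero =>
    ext x k
    simp [combine_apply, Matrix.one_apply]
  | succ m ih =>
    ext x k
    rw [pow_succ' (combine A), ← ih, mul_apply_eq_comp, combine_apply, combine_apply]
    simp only [combine_apply, pow_succ, Matrix.mul_apply, Finset.sum_smul, Finset.smul_sum,
      smul_smul]
    rw [Finset.sum_comm]
    exact Finset.sum_congr rfl fun i _ => Finset.sum_congr rfl fun j _ => by rw [mul_comm]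

theorem norm_combine_le {A : Matrix n n ℝ} (hA : ∀ i j, 0 ≤ A i j) (hsum : ∀ k, ∑ ℓ, A ℓ k = 1)
    (x : n → E) : ‖combine A x‖ ≤ ‖x‖ := by
  refine (pi_norm_le_iff_of_nonneg (norm_nonneg x)).2 fun k => ?_
  rw [combine_apply]
  calc ‖∑ ℓ, A ℓ k • x ℓ‖ ≤ ∑ ℓ, A ℓ k * ‖x‖ := norm_sum_le_of_le _ fun ℓ _ => by
        rw [norm_smul, Real.norm_of_nonneg (hA ℓ k)]
        exact mul_le_mul_of_nonneg_left (norm_le_pi_norm x ℓ) (hA ℓ k)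
    _ = ‖x‖ := by rw [← Finset.sum_mul, hsum, one_mul]

theorem sum_pow_apply_eq_one [DecidableEq n] {A : Matrix n n ℝ} (hsum : ∀ k, ∑ ℓ, A ℓ k = 1)
    (m : ℕ) (k : n) : ∑ ℓ, (A ^ m) ℓ k = 1 := by
  induction m generalizing k with
  | zero => simp [Matrix.one_apply]
  | succ m ih =>
    simp only [pow_succ, Matrix.mul_apply]
    rw [Finset.sum_comm]
    simp [← Finset.sum_mul, ih, hsum]

end Combine

section Centroid

variable {S R : ℕ} {NS : Fin S → ℕ} {NR : Fin R → ℕ} {A : Matrix (Agent NS NR) (Agent NS NR) ℝ}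
  {E : Type*} [NormedAddCommGroup E] [NormedSpace ℝ E]

/-- The Perron-weighted centroids of the sending sub-networks. -/
noncomputable def centroid (NR : Fin R → ℕ) (p : (s : Fin S) → Fin (NS s) → ℝ) :
    (Agent NS NR → E) →L[ℝ] (Fin S → E) :=
  ContinuousLinearMap.pi fun s => ∑ k, p s k • ContinuousLinearMap.proj (Sum.inl ⟨s, k⟩)

theorem centroid_apply (p : (s : Fin S) → Fin (NS s) → ℝ) (x : Agent NS NR → E) (s : Fin S) :
    centroid NR p x s = ∑ k, p s k • x (Sum.inl ⟨s, k⟩) := by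
  simp [centroid]

theorem IsWeaklyConnected.combine_inl (hA : IsWeaklyConnected A) (x : Agent NS NR → E) (s : Fin S)
    (k : Fin (NS s)) :
    combine A x (Sum.inl ⟨s, k⟩) = ∑ ℓ, sendBlock A s ℓ k • x (Sum.inl ⟨s, ℓ⟩) := by
  rw [combine_apply, Fintype.sum_sum_type,
    Finset.sum_eq_zero (s := Finset.univ (α := RAgent NR))
      fun a _ => by rw [hA.recv_send a ⟨s, k⟩, zero_smul],
    add_zero, Fintype.sum_sigma, Finset.sum_eq_single s]
  · rfl
  · intro s' _ hs'
    exact Finset.sum_eq_zero fun i _ => by rw [hA.send_send ⟨s', i⟩ ⟨s, k⟩ hs', zero_smul]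
  · simp

/-- The combination step preserves the centroids. -/
theorem IsWeaklyConnected.centroid_combine (hA : IsWeaklyConnected A)
    {p : (s : Fin S) → Fin (NS s) → ℝ} (hp : ∀ s, IsPerronVector (sendBlock A s) (p s))
    (x : Agent NS NR → E) : centroid NR p (combine A x) = centroid NR p x := by
  funext s
  simp only [centroid_apply, hA.combine_inl, Finset.smul_sum, smul_smul]
  rw [Finset.sum_comm]
  refine Finset.sum_congr rfl fun ℓ _ => ?_
  rw [← Finset.sum_smul]
  congr 1
  conv_rhs => rw [← (hp s).1]
  exact Finset.sum_congr rfl fun k _ => mul_comm _ _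

/-- On stacked vectors with zero centroids, a power of the combination step is a contraction: by
the minorization, a multiple of one of the centroids may be subtracted from each output without
making any weight negative. -/
theorem IsWeaklyConnected.exists_norm_combine_pow_le (hA : IsWeaklyConnected A)
    {p : (s : Fin S) → Fin (NS s) → ℝ} (hp : ∀ s, IsPerronVector (sendBlock A s) (p s)) :
    ∃ (m : ℕ) (ρ : ℝ), 0 ≤ ρ ∧ ρ < 1 ∧
      ∀ x : Agent NS NR → E, centroid NR p x = 0 → ‖(combine A ^ m) x‖ ≤ ρ * ‖x‖ := by
  obtain ⟨m, η, h0, h1, h⟩ := hA.exists_minorization p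
  refine ⟨m, 1 - η, by linarith, by linarith, fun x hx => ?_⟩
  rw [← combine_pow]
  refine (pi_norm_le_iff_of_nonneg (mul_nonneg (by linarith) (norm_nonneg x))).2 fun k => ?_
  obtain ⟨s, hs⟩ := h k
  let u : Agent NS NR → ℝ := Sum.elim (fun a => if a.1 = s then η * p a.1 a.2 else 0) fun _ => 0
  have hu : ∀ ℓ, u ℓ ≤ (A ^ m) ℓ k := by
    rintro (⟨s', ℓ⟩ | a)
    · by_cases hss : s' = s
      · subst hss
        simpa [u] using hs ℓ
      · simpa [u, hss] using pow_apply_nonneg hA.nonneg m _ k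
    · exact pow_apply_nonneg hA.nonneg m _ k
  have husum : ∑ ℓ, u ℓ = η := by
    rw [Fintype.sum_sum_type, Fintype.sum_sigma, Finset.sum_eq_single s]
    · simp [u, ← Finset.mul_sum, (hp s).2.1]
    · intro s' _ hs'
      simp [u, hs']
    · simp
  have hux : ∑ ℓ, u ℓ • x ℓ = 0 := by
    have h0 : ∑ k, p s k • x (Sum.inl ⟨s, k⟩) = 0 := by
      rw [← centroid_apply, hx, Pi.zero_apply]
    rw [Fintype.sum_sum_type, Fintype.sum_sigma, Finset.sum_eq_single s]
    · simp [u, mul_smul, ← Finset.smul_sum, h0]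
    · intro s' _ hs'
      simp [u, hs']
    · simp
  -- The weights `A ^ m - u` are nonnegative with sum `1 - η`, and give the same output as `A ^ m`.
  have heq : combine (A ^ m) x k = ∑ ℓ, ((A ^ m) ℓ k - u ℓ) • x ℓ := by
    simp [combine_apply, sub_smul, Finset.sum_sub_distrib, hux]
  rw [heq]
  calc ‖∑ ℓ, ((A ^ m) ℓ k - u ℓ) • x ℓ‖ ≤ ∑ ℓ, ((A ^ m) ℓ k - u ℓ) * ‖x‖ :=
        norm_sum_le_of_le _ fun ℓ _ => by
          rw [norm_smul, Real.norm_of_nonneg (sub_nonneg.2 (hu ℓ))]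
          exact mul_le_mul_of_nonneg_left (norm_le_pi_norm x ℓ) (sub_nonneg.2 (hu ℓ))
    _ = (1 - η) * ‖x‖ := by
        rw [← Finset.sum_mul, Finset.sum_sub_distrib, sum_pow_apply_eq_one hA.colSum, husum]

/-- A left fixed vector of `T_RR`, extended by zero to the sending agents, is fixed by the
combination step and has zero centroids; hence it vanishes. -/
theorem IsWeaklyConnected.isUnit_one_sub_TRR (hA : IsWeaklyConnected A) :
    IsUnit (1 - TRR A) := by
  rw [Matrix.isUnit_iff_isUnit_det, isUnit_iff_ne_zero]
  intro hdet
  obtain ⟨v, hv0, hv⟩ := Matrix.exists_vecMul_eq_zero_iff.2 hdet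
  rw [Matrix.vecMul_sub, Matrix.vecMul_one, sub_eq_zero] at hv
  choose p hp using fun s => (hA.existsUnique_perron s).exists
  obtain ⟨m, ρ, -, hρ, h⟩ := hA.exists_norm_combine_pow_le (E := ℝ) hp
  let x : Agent NS NR → ℝ := Sum.elim (fun _ => 0) v
  have hfix : combine A x = x := by
    funext k
    rcases k with ⟨s, k⟩ | k
    · simp [hA.combine_inl, x]
    · rw [combine_apply, Fintype.sum_sum_type]
      have := congrFun hv k
      simp only [x, Sum.elim_inl, Sum.elim_inr, smul_zero, Finset.sum_const_zero, zero_add]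
      rw [this]
      exact Finset.sum_congr rfl fun ℓ _ => mul_comm _ _
  have hpow : ∀ j, (combine A ^ j) x = x := by
    intro j
    induction j with
    | zero => simp
    | succ j ih => rw [pow_succ', mul_apply_eq_comp, ih, hfix]
  have hle := h x (by funext s; simp [centroid_apply, x])
  rw [hpow] at hle
  have hx : ‖x‖ = 0 := by nlinarith [norm_nonneg x]
  exact hv0 (funext fun k => congrFun (norm_eq_zero.1 hx) (Sum.inr k))

/-- The linear map that sends one value per sending sub-network to the stacked vector of limit
points that these values determine: sending agents take the value of their sub-network, receiving
agents the combination given by `W`. -/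
noncomputable def spread (A : Matrix (Agent NS NR) (Agent NS NR) ℝ) :
    (Fin S → E) →L[ℝ] (Agent NS NR → E) :=
  ContinuousLinearMap.pi <| Sum.rec (fun a => ContinuousLinearMap.proj a.1)
    fun a => ∑ b : SAgent NS, W A b a • ContinuousLinearMap.proj b.1

theorem spread_inl (c : Fin S → E) (a : SAgent NS) : spread A c (Sum.inl a) = c a.1 := rfl

theorem spread_inr (c : Fin S → E) (a : RAgent NR) :
    spread A c (Sum.inr a) = ∑ b : SAgent NS, W A b a • c b.1 := by
  simp [spread]

theorem limitPoint_eq_spread {M : ℕ} (wS : Fin S → EuclideanSpace ℝ (Fin M)) :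
    limitPoint A wS = spread A wS := by
  funext k
  rcases k with a | a
  · rfl
  · rw [spread_inr]
    ext m
    simp [limitPoint, stackR, stackS, Matrix.mulVec, dotProduct, Fintype.sum_prod_type,
      Matrix.kronecker, Matrix.one_apply]

theorem centroid_spread {p : (s : Fin S) → Fin (NS s) → ℝ} (hp : ∀ s, ∑ k, p s k = 1)
    (c : Fin S → E) : centroid NR p (spread A c) = c := by
  funext s
  simp [centroid_apply, spread_inl, ← Finset.sum_smul, hp]

/-- The limit points are a fixed point of the combination step, as `W = T_SR + W T_RR`. -/
theorem IsWeaklyConnected.combine_spread (hA : IsWeaklyConnected A) (c : Fin S → E) :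
    combine A (spread A c) = spread A c := by
  have hW : W A = TSR A + W A * TRR A := by
    have : W A * (1 - TRR A) = TSR A := by
      rw [W, Matrix.mul_assoc, Matrix.nonsing_inv_mul _
        ((Matrix.isUnit_iff_isUnit_det _).1 hA.isUnit_one_sub_TRR), Matrix.mul_one]
    rw [← this, Matrix.mul_sub, Matrix.mul_one]
    abel
  funext k
  rcases k with ⟨s, k⟩ | k
  · rw [hA.combine_inl, spread_inl]
    simp only [spread_inl]
    rw [← Finset.sum_smul]
    have h1 := hA.combine_inl (fun _ => (1 : ℝ)) s k
    simp only [combine_apply, smul_eq_mul, mul_one, hA.colSum] at h1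
    rw [← h1, one_smul]
  · rw [combine_apply, Fintype.sum_sum_type]
    simp only [spread_inl, spread_inr, Finset.smul_sum, smul_smul]
    rw [Finset.sum_comm, ← Finset.sum_add_distrib]
    refine Finset.sum_congr rfl fun b _ => ?_
    rw [← Finset.sum_smul, ← add_smul]
    congr 1
    conv_rhs => rw [hW]
    rw [Matrix.add_apply, Matrix.mul_apply]
    congr 1
    exact Finset.sum_congr rfl fun _ _ => mul_comm _ _

end Centroid

/-! ### A quadratic Lyapunov function -/

section Lyapunov

variable {n E : Type*} [Fintype n] [NormedAddCommGroup E] [InnerProductSpace ℝ E]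

/-- The inner product of stacked vectors. -/
noncomputable def stackInner (n E : Type*) [Fintype n] [NormedAddCommGroup E]
    [InnerProductSpace ℝ E] : (n → E) →L[ℝ] (n → E) →L[ℝ] ℝ :=
  ∑ k, (innerSL ℝ).bilinearComp (ContinuousLinearMap.proj k) (ContinuousLinearMap.proj k)

theorem stackInner_self (x : n → E) : stackInner n E x x = ∑ k, ‖x k‖ ^ 2 := by
  simp [stackInner]

theorem sq_norm_le_stackInner (x : n → E) : ‖x‖ ^ 2 ≤ stackInner n E x x := by
  rw [stackInner_self]
  have h : ‖x‖ ≤ √(∑ k, ‖x k‖ ^ 2) := by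
    refine (pi_norm_le_iff_of_nonneg (Real.sqrt_nonneg _)).2 fun k => Real.le_sqrt_of_sq_le ?_
    exact Finset.single_le_sum (f := fun k => ‖x k‖ ^ 2) (fun i _ => sq_nonneg _)
      (Finset.mem_univ k)
  calc ‖x‖ ^ 2 ≤ √(∑ k, ‖x k‖ ^ 2) ^ 2 := pow_le_pow_left₀ (norm_nonneg x) h 2
    _ = _ := Real.sq_sqrt (Finset.sum_nonneg fun _ _ => sq_nonneg _)

theorem stackInner_le_sq_norm (x : n → E) :
    stackInner n E x x ≤ (Fintype.card n + 1) * ‖x‖ ^ 2 := by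
  rw [stackInner_self]
  calc ∑ k, ‖x k‖ ^ 2 ≤ ∑ _k : n, ‖x‖ ^ 2 := Finset.sum_le_sum fun k _ =>
        pow_le_pow_left₀ (norm_nonneg _) (norm_le_pi_norm x k) 2
    _ = Fintype.card n * ‖x‖ ^ 2 := by simp
    _ ≤ _ := by nlinarith [sq_nonneg ‖x‖]

/-- Summation by parts, with the linear weights `c + j`. -/
theorem sum_shift_eq (f : ℕ → ℝ) (c : ℝ) (m : ℕ) :
    ∑ j ∈ Finset.range m, (c + j) * f (j + 1) + ∑ j ∈ Finset.range m, f j =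
      ∑ j ∈ Finset.range m, (c + j) * f j + (c + m - 1) * f m - (c - 1) * f 0 := by
  induction m with
  | zero => simp
  | succ m ih =>
    simp only [Finset.sum_range_succ]
    push_cast
    linear_combination ih

/-- A nonexpansive map with a power that contracts an invariant subspace decreases, on that
subspace, a quadratic form equivalent to the squared norm, by a fixed factor. The form is
`∑ j < L, (L + j) |T^j x|²`: a step of `T` shifts the summands, and the increasing weights turn the
shift into a loss of `L |x|²`, up to a final term that is small for large `L`. -/
theorem exists_lyapunov_form {T : (n → E) →L[ℝ] (n → E)} (hT : ∀ x, ‖T x‖ ≤ ‖x‖)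
    {U : Set (n → E)} (hU : ∀ x ∈ U, T x ∈ U) {m : ℕ} {ρ : ℝ} (h0 : 0 ≤ ρ) (h1 : ρ < 1)
    (hm : ∀ x ∈ U, ‖(T ^ m) x‖ ≤ ρ * ‖x‖) :
    ∃ (b : (n → E) →L[ℝ] (n → E) →L[ℝ] ℝ) (K ε : ℝ), 0 ≤ K ∧ 0 < ε ∧ ε ≤ 1 ∧
      (∀ x, ‖x‖ ^ 2 ≤ b x x) ∧ (∀ x, b x x ≤ K * ‖x‖ ^ 2) ∧
      ∀ x ∈ U, b (T x) (T x) ≤ (1 - ε) * b x x := by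
  set N : ℝ := Fintype.card n + 1 with hN
  have hN1 : 1 ≤ N := by simp [hN]
  have hpowle : ∀ (j : ℕ) (x : n → E), ‖(T ^ j) x‖ ≤ ‖x‖ := by
    intro j
    induction j with
    | zero => intro x; simp
    | succ j ih =>
      intro x
      rw [pow_succ', mul_apply_eq_comp]
      exact (hT _).trans (ih x)
  have hUpow : ∀ (j : ℕ), ∀ x ∈ U, (T ^ j) x ∈ U := by
    intro j
    induction j with
    | zero => intro x hx; simpa using hx
    | succ j ih =>
      intro x hx
      rw [pow_succ', mul_apply_eq_comp]
      exact hU _ (ih x hx)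
  have hmj : ∀ (j : ℕ), ∀ x ∈ U, ‖(T ^ (m * j)) x‖ ≤ ρ ^ j * ‖x‖ := by
    intro j
    induction j with
    | zero => intro x _; simp
    | succ j ih =>
      intro x hx
      rw [Nat.mul_succ, pow_add, mul_apply_eq_comp]
      calc _ ≤ ρ ^ j * ‖(T ^ m) x‖ := ih _ (hUpow m x hx)
        _ ≤ ρ ^ j * (ρ * ‖x‖) := mul_le_mul_of_nonneg_left (hm x hx) (pow_nonneg h0 j)
        _ = _ := by ring
  obtain ⟨j, hj⟩ : ∃ j : ℕ, N * ρ ^ j < 1 / 4 := by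
    have := (tendsto_pow_atTop_nhds_zero_of_lt_one h0 h1).const_mul N
    rw [mul_zero] at this
    exact (this.eventually_lt_const (by norm_num)).exists
  set L : ℕ := m * j + 1 with hL
  have hL1 : (1 : ℝ) ≤ L := by exact_mod_cast Nat.succ_pos (m * j)
  have hTL : ∀ x ∈ U, N * ‖(T ^ L) x‖ ^ 2 ≤ 1 / 4 * ‖x‖ ^ 2 := by
    intro x hx
    have h2 : ‖(T ^ L) x‖ ≤ ρ ^ j * ‖x‖ := by
      rw [hL, pow_succ', mul_apply_eq_comp]
      exact (hT _).trans (hmj j x hx)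
    have h3 : ρ ^ j ≤ 1 := pow_le_one₀ h0 h1.le
    have h4 : ρ ^ j ≥ 0 := pow_nonneg h0 j
    calc N * ‖(T ^ L) x‖ ^ 2 ≤ N * (ρ ^ j * ‖x‖) ^ 2 := by gcongr
      _ = (N * ρ ^ j) * ρ ^ j * ‖x‖ ^ 2 := by ring
      _ ≤ 1 / 4 * 1 * ‖x‖ ^ 2 := by gcongr
      _ = _ := by ring
  let b : (n → E) →L[ℝ] (n → E) →L[ℝ] ℝ :=
    ∑ i ∈ Finset.range L, ((L : ℝ) + i) • (stackInner n E).bilinearComp (T ^ i) (T ^ i)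
  have hb : ∀ x, b x x =
      ∑ i ∈ Finset.range L, ((L : ℝ) + i) * stackInner n E ((T ^ i) x) ((T ^ i) x) := by
    intro x
    simp [b]
  have hq0 : ∀ x : n → E, 0 ≤ stackInner n E x x := fun x =>
    (sq_nonneg _).trans (sq_norm_le_stackInner x)
  have hup : ∀ x, b x x ≤ 2 * L ^ 2 * N * ‖x‖ ^ 2 := by
    intro x
    rw [hb]
    calc _ ≤ ∑ _i ∈ Finset.range L, 2 * L * (N * ‖x‖ ^ 2) := by
          refine Finset.sum_le_sum fun i hi => ?_
          have hi : (i : ℝ) ≤ L := by exact_mod_cast (Finset.mem_range.1 hi).le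
          refine mul_le_mul (by linarith) ?_ (hq0 _) (by positivity)
          refine (stackInner_le_sq_norm _).trans ?_
          have := hpowle i x
          gcongr
      _ = _ := by simp; ring
  refine ⟨b, 2 * L ^ 2 * N, 1 / (4 * L * N), by positivity, by positivity, ?_, ?_, hup, ?_⟩
  · rw [div_le_one (by positivity)]
    nlinarith
  · intro x
    rw [hb]
    have h2 := Finset.single_le_sum (s := Finset.range L)
      (f := fun i : ℕ => ((L : ℝ) + i) * stackInner n E ((T ^ i) x) ((T ^ i) x))
      (fun i _ => mul_nonneg (by positivity) (hq0 _)) (Finset.mem_range.2 (Nat.succ_pos (m * j)))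
    have h3 := sq_norm_le_stackInner x
    simp only [Nat.cast_zero, add_zero, pow_zero, one_apply_eq_self] at h2
    refine le_trans ?_ h2
    nlinarith [hq0 x]
  · intro x hx
    have hshift := sum_shift_eq (fun i => stackInner n E ((T ^ i) x) ((T ^ i) x)) L L
    have hTb : b (T x) (T x) = ∑ i ∈ Finset.range L,
        ((L : ℝ) + i) * stackInner n E ((T ^ (i + 1)) x) ((T ^ (i + 1)) x) := by
      rw [hb]
      simp only [pow_succ, mul_apply_eq_comp]
    have hfirst := Finset.single_le_sum (s := Finset.range L)
      (f := fun i : ℕ => stackInner n E ((T ^ i) x) ((T ^ i) x))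
      (fun i _ => hq0 _) (Finset.mem_range.2 (Nat.succ_pos (m * j)))
    have hlast : stackInner n E ((T ^ L) x) ((T ^ L) x) ≤ 1 / 4 * stackInner n E x x :=
      (stackInner_le_sq_norm _).trans ((hTL x hx).trans
        (mul_le_mul_of_nonneg_left (sq_norm_le_stackInner x) (by norm_num)))
    rw [← hTb, ← hb] at hshift
    simp only [pow_zero, one_apply_eq_self] at hshift hfirst
    have hdec : b (T x) (T x) ≤ b x x - L / 2 * stackInner n E x x := by
      have := mul_le_mul_of_nonneg_left hlast (show (0 : ℝ) ≤ 2 * L - 1 by linarith)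
      nlinarith [hq0 x]
    have hεb : 1 / (4 * L * N) * b x x ≤ L / 2 * stackInner n E x x := by
      calc _ ≤ 1 / (4 * L * N) * (2 * L ^ 2 * N * stackInner n E x x) := by
            refine mul_le_mul_of_nonneg_left ((hup x).trans ?_) (by positivity)
            exact mul_le_mul_of_nonneg_left (sq_norm_le_stackInner x) (by positivity)
        _ = _ := by
            field_simp
            ring
    linarith

end Lyapunov

/-! ### Second moments along the diffusion iterates -/

section Moments

variable {Ω X : Type*} {m : MeasurableSpace Ω} [mΩ : MeasurableSpace Ω] {P : Measure Ω}
  [IsProbabilityMeasure P] [NormedAddCommGroup X] [NormedSpace ℝ X] [CompleteSpace X]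

theorem integral_bilin_eq_zero (hm : m ≤ mΩ) (b : X →L[ℝ] X →L[ℝ] ℝ) {u s : Ω → X}
    (hu : StronglyMeasurable[m] u) (hu2 : MemLp u 2 P) (hs2 : MemLp s 2 P)
    (hs : condExp m P s =ᵐ[P] 0) : ∫ ω, b (u ω) (s ω) ∂P = 0 := by
  have hint : Integrable (fun ω => b (u ω) (s ω)) P :=
    memLp_one_iff_integrable.1 (b.memLp_of_bilin 1 hu2 hs2)
  have hpull := condExp_bilin_of_stronglyMeasurable_left b hu hint (hs2.integrable one_le_two)
  rw [← integral_condExp hm]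
  refine integral_eq_zero_of_ae ?_
  filter_upwards [hpull, hs] with ω h1 h2
  rw [h1, h2]
  simp

/-- A quadratic form of `u - s`, where `u` is known and `s` is centered given the past, has no
cross term in expectation. -/
theorem integral_quadratic_sub (hm : m ≤ mΩ) (b : X →L[ℝ] X →L[ℝ] ℝ) {u s : Ω → X}
    (hu : StronglyMeasurable[m] u) (hu2 : MemLp u 2 P) (hs2 : MemLp s 2 P)
    (hs : condExp m P s =ᵐ[P] 0) :
    ∫ ω, b (u ω - s ω) (u ω - s ω) ∂P = ∫ ω, b (u ω) (u ω) ∂P + ∫ ω, b (s ω) (s ω) ∂P := by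
  have hint : ∀ (b : X →L[ℝ] X →L[ℝ] ℝ) {f g : Ω → X}, MemLp f 2 P → MemLp g 2 P →
      Integrable (fun ω => b (f ω) (g ω)) P := fun b _ _ hf hg =>
    memLp_one_iff_integrable.1 (b.memLp_of_bilin 1 hf hg)
  have h1 := integral_bilin_eq_zero hm (b + b.flip) hu hu2 hs2 hs
  have hexp : ∀ ω, b (u ω - s ω) (u ω - s ω) =
      b (u ω) (u ω) + b (s ω) (s ω) - (b + b.flip) (u ω) (s ω) := fun ω => by
    simp
    ring
  simp only [hexp]
  have hadd : Integrable (fun ω => b (u ω) (u ω) + b (s ω) (s ω)) P :=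
    (hint b hu2 hu2).add (hint b hs2 hs2)
  rw [integral_sub hadd (hint _ hu2 hs2),
    integral_add (hint b hu2 hu2) (hint b hs2 hs2), h1, sub_zero]

end Moments

theorem condExp_stack_ae_eq_zero {n E Ω : Type*} [Fintype n] [NormedAddCommGroup E]
    [NormedSpace ℝ E] [CompleteSpace E] {m : MeasurableSpace Ω} [MeasurableSpace Ω]
    {P : Measure Ω} {s : Ω → n → E} (hint : Integrable s P)
    (hs : ∀ k, condExp m P (fun ω => s ω k) =ᵐ[P] 0) : condExp m P s =ᵐ[P] 0 := by
  have hcomp : ∀ k, ∀ᵐ ω ∂P, condExp m P s ω k = 0 := by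
    intro k
    filter_upwards [(ContinuousLinearMap.proj (R := ℝ) (φ := fun _ : n => E) k).comp_condExp_comm
      hint (m := m), hs k] with ω h1 h2
    exact h1.trans h2
  filter_upwards [ae_all_iff.2 hcomp] with ω h
  exact funext h

theorem pastEvents_le {n E Ω : Type*} [MeasurableSpace E] [mΩ : MeasurableSpace Ω]
    {w : ℕ → n → Ω → E} (hw : ∀ i k, Measurable (w i k)) (i : ℕ) :
    pastEvents w i ≤ mΩ :=
  iSup_le fun j => iSup_le fun k => (hw j k).comap_le

theorem stronglyMeasurable_pastEvents {n E Ω : Type*} [Fintype n] [NormedAddCommGroup E]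
    [InnerProductSpace ℝ E] [FiniteDimensional ℝ E] [MeasurableSpace E] [BorelSpace E]
    (w : ℕ → n → Ω → E) (i : ℕ) :
    StronglyMeasurable[pastEvents w i] fun ω k => w i k ω := by
  have h : ∀ k, Measurable[pastEvents w i] (w i k) := fun k =>
    measurable_iff_comap_le.2 (le_iSup_of_le (Fin.last i) (le_iSup_of_le k le_rfl))
  have hpi : Measurable[pastEvents w i] fun ω k => w i k ω := @measurable_pi_lambda _ _ _
    (pastEvents w i) _ _ h
  exact hpi.stronglyMeasurable

theorem memLp_gradient_comp {E Ω : Type*} [NormedAddCommGroup E] [InnerProductSpace ℝ E]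
    [CompleteSpace E] [MeasurableSpace Ω] {P : Measure Ω} [IsProbabilityMeasure P] {f : E → ℝ}
    {δ : ℝ} {v : Ω → E} (hf : Continuous (∇ f))
    (hδ : ∀ x, ‖∇ f x‖ ≤ ‖∇ f 0‖ + δ * ‖x‖) (hv : MemLp v 2 P) :
    MemLp (fun ω => ∇ f (v ω)) 2 P := by
  have h1 : MemLp (fun ω => ‖∇ f 0‖ + δ * ‖v ω‖) 2 P :=
    (memLp_const (‖∇ f 0‖ : ℝ)).add (hv.norm.const_mul δ)
  refine MemLp.of_le h1 (hf.comp_aestronglyMeasurable hv.1) (ae_of_all _ fun ω => ?_)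
  rw [Real.norm_eq_abs]
  exact (hδ (v ω)).trans (le_abs_self _)

section MeanStep

variable {n E Ω : Type*} [Fintype n] [NormedAddCommGroup E] [InnerProductSpace ℝ E]
  [CompleteSpace E] {A : Matrix n n ℝ} {μ : n → ℝ} {J : n → E → ℝ} {gHat : n → ℕ → E → Ω → E}
  {w0 : n → Ω → E}

/-- One noiseless step of the diffusion strategy, in terms of the error `x = w - wstar`, where
`wstar` is a fixed point of the combination step. -/
noncomputable def meanStep (A : Matrix n n ℝ) (μ : n → ℝ) (J : n → E → ℝ) (wstar x : n → E) :
    n → E :=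
  combine A fun k => x k - μ k • ∇ (J k) (wstar k + x k)

theorem iterate_succ_sub {wstar : n → E} (hstar : combine A wstar = wstar) (i : ℕ) (ω : Ω) :
    (fun k => iterate A μ gHat w0 (i + 1) k ω) - wstar =
      meanStep A μ J wstar ((fun k => iterate A μ gHat w0 i k ω) - wstar) -
        combine A fun k => μ k • gradientNoise J gHat k (i + 1) (iterate A μ gHat w0 i k ω) ω := by
  have h : (fun k => iterate A μ gHat w0 (i + 1) k ω) = combine A fun ℓ =>
      iterate A μ gHat w0 i ℓ ω - μ ℓ • gHat ℓ (i + 1) (iterate A μ gHat w0 i ℓ ω) ω := by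
    funext k
    rw [combine_apply]
    rfl
  rw [h, meanStep]
  conv_lhs => rw [← hstar]
  rw [← map_sub, ← map_sub]
  congr 1
  funext k
  simp only [Pi.sub_apply, gradientNoise, add_sub_cancel, smul_sub]
  abel

end MeanStep

section Diffusion

variable {n E Ω : Type*} [Fintype n] [NormedAddCommGroup E] [InnerProductSpace ℝ E]
  [FiniteDimensional ℝ E] [MeasurableSpace E] [BorelSpace E] [mΩ : MeasurableSpace Ω]
  {P : Measure Ω} [IsProbabilityMeasure P] {A : Matrix n n ℝ} {μ : n → ℝ} {J : n → E → ℝ}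
  {gHat : n → ℕ → E → Ω → E} {w0 : n → Ω → E} {β σ : n → ℝ}

theorem measurable_iterate
    (hmeas : ∀ k i, Measurable fun ω => gHat k (i + 1) (iterate A μ gHat w0 i k ω) ω)
    (hw0 : ∀ k, Measurable (w0 k)) (i : ℕ) (k : n) : Measurable (iterate A μ gHat w0 i k) := by
  induction i generalizing k with
  | zero => exact hw0 k
  | succ i ih =>
    exact Finset.measurable_fun_sum _ fun ℓ _ =>
      ((ih ℓ).sub ((hmeas ℓ i).const_smul _)).const_smul _

/-- The conditional second-moment bound, integrated. It also makes the noise square integrable;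
without that, the vanishing of `condExp` would hold by convention and carry no information. -/
theorem memLp_gradientNoise (hn : NoiseConditions P J gHat (iterate A μ gHat w0) β σ)
    (hJ : ∀ k, Continuous (∇ (J k))) (hw0 : ∀ k, Measurable (w0 k)) {i : ℕ} {k : n}
    (hw : MemLp (iterate A μ gHat w0 i k) 2 P) :
    MemLp (fun ω => gradientNoise J gHat k (i + 1) (iterate A μ gHat w0 i k ω) ω) 2 P ∧
      ∫ ω, ‖gradientNoise J gHat k (i + 1) (iterate A μ gHat w0 i k ω) ω‖ ^ 2 ∂P ≤
        β k ^ 2 * ∫ ω, ‖iterate A μ gHat w0 i k ω‖ ^ 2 ∂P + σ k ^ 2 := by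
  set w := iterate A μ gHat w0 with hw_def
  set s : Ω → E := fun ω => gradientNoise J gHat k (i + 1) (w i k ω) ω with hs_def
  have hmeasw := measurable_iterate hn.measurable hw0
  have hs : Measurable s := (hn.measurable k i).sub ((hJ k).measurable.comp (hmeasw i k))
  have hle := pastEvents_le hmeasw i
  have hwsq : Integrable (fun ω => ‖w i k ω‖ ^ 2) P :=
    (memLp_two_iff_integrable_sq_norm hw.1).1 hw
  have hbint : Integrable (fun ω => β k ^ 2 * ‖w i k ω‖ ^ 2 + σ k ^ 2) P :=
    (hwsq.const_mul _).add (integrable_const _)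
  have hb : ∫⁻ ω, ‖s ω‖ₑ ^ 2 ∂P ≤
      ENNReal.ofReal (∫ ω, (β k ^ 2 * ‖w i k ω‖ ^ 2 + σ k ^ 2) ∂P) := by
    rw [← lintegral_condLExp hle, ofReal_integral_eq_lintegral_ofReal hbint
      (ae_of_all _ fun ω => by positivity)]
    exact lintegral_mono_ae (hn.second_moment k i)
  have hsq : ∀ ω, ‖s ω‖ₑ ^ 2 = ENNReal.ofReal (‖s ω‖ ^ 2) := fun ω => by
    rw [← ofReal_norm, ENNReal.ofReal_pow (norm_nonneg _)]
  have hsint : Integrable (fun ω => ‖s ω‖ ^ 2) P := by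
    refine ⟨(hs.norm.pow_const 2).aestronglyMeasurable, ?_⟩
    rw [hasFiniteIntegral_iff_ofReal (ae_of_all _ fun ω => by positivity)]
    simp only [← hsq]
    exact hb.trans_lt ENNReal.ofReal_lt_top
  refine ⟨(memLp_two_iff_integrable_sq_norm hs.aestronglyMeasurable).2 hsint, ?_⟩
  simp only [hsq] at hb
  rw [← ofReal_integral_eq_lintegral_ofReal hsint (ae_of_all _ fun ω => by positivity),
    ENNReal.ofReal_le_ofReal_iff (integral_nonneg fun ω => by positivity)] at hb
  rw [integral_add (hwsq.const_mul _) (integrable_const _), integral_const_mul] at hb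
  simpa using hb

theorem memLp_iterate (hn : NoiseConditions P J gHat (iterate A μ gHat w0) β σ)
    (hJ : ∀ k, Continuous (∇ (J k))) {δ : ℝ} (hδ : ∀ k x, ‖∇ (J k) x‖ ≤ ‖∇ (J k) 0‖ + δ * ‖x‖)
    (hw0 : ∀ k, Measurable (w0 k) ∧ MemLp (w0 k) 2 P) (i : ℕ) (k : n) :
    MemLp (iterate A μ gHat w0 i k) 2 P := by
  induction i generalizing k with
  | zero => exact (hw0 k).2
  | succ i ih =>
    have hg : ∀ ℓ, MemLp (fun ω => gHat ℓ (i + 1) (iterate A μ gHat w0 i ℓ ω) ω) 2 P := by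
      intro ℓ
      have h1 := (memLp_gradientNoise hn hJ (fun k => (hw0 k).1) (ih ℓ)).1
      have h2 := h1.add (memLp_gradient_comp (hJ ℓ) (hδ ℓ) (ih ℓ))
      refine h2.ae_eq (ae_of_all _ fun ω => ?_)
      simp [gradientNoise]
    exact memLp_finsetSum _ fun ℓ _ => ((ih ℓ).sub ((hg ℓ).const_smul (μ ℓ))).const_smul (A ℓ k)

/-- If a quadratic form decreases along the noiseless recursion, up to a constant, then so does its
expectation along the diffusion strategy, up to a further noise term. -/
theorem integral_quadratic_succ_le (hn : NoiseConditions P J gHat (iterate A μ gHat w0) β σ)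
    (hJ : ∀ k, Continuous (∇ (J k))) {δ : ℝ} (hδ : ∀ k x, ‖∇ (J k) x‖ ≤ ‖∇ (J k) 0‖ + δ * ‖x‖)
    (hw0 : ∀ k, Measurable (w0 k) ∧ MemLp (w0 k) 2 P) {wstar : n → E}
    (hstar : combine A wstar = wstar) (hcomb : ∀ x : n → E, ‖combine A x‖ ≤ ‖x‖)
    {μmax : ℝ} (hμ : ∀ k, |μ k| ≤ μmax)
    {b : (n → E) →L[ℝ] (n → E) →L[ℝ] ℝ} {r κ c K : ℝ}
    (hK : 0 ≤ K) (hbK : ∀ x, b x x ≤ K * ‖x‖ ^ 2)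
    (hdet : ∀ x, b (meanStep A μ J wstar x) (meanStep A μ J wstar x) ≤ r * b x x + κ)
    (hc : ∀ x, ‖x‖ ^ 2 ≤ c * b x x) (i : ℕ) :
    ∫ ω, b ((fun k => iterate A μ gHat w0 (i + 1) k ω) - wstar)
        ((fun k => iterate A μ gHat w0 (i + 1) k ω) - wstar) ∂P ≤
      r * ∫ ω, b ((fun k => iterate A μ gHat w0 i k ω) - wstar)
        ((fun k => iterate A μ gHat w0 i k ω) - wstar) ∂P + κ +
      K * μmax ^ 2 *
        ((∑ k, (2 * β k ^ 2 * (1 + ‖wstar‖ ^ 2) + σ k ^ 2)) *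
          (1 + c * ∫ ω, b ((fun k => iterate A μ gHat w0 i k ω) - wstar)
            ((fun k => iterate A μ gHat w0 i k ω) - wstar) ∂P)) := by
  set w := iterate A μ gHat w0 with hw_def
  set e : ℕ → Ω → n → E := fun i ω => (fun k => w i k ω) - wstar with he_def
  set s : n → Ω → E := fun k ω => gradientNoise J gHat k (i + 1) (w i k ω) ω with hs_def
  set y : Ω → n → E := fun ω => combine A fun k => μ k • s k ω with hy_def
  have hwL : ∀ i k, MemLp (w i k) 2 P := memLp_iterate hn hJ hδ hw0
  have hsL := fun k => memLp_gradientNoise hn hJ (fun k => (hw0 k).1) (hwL i k)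
  have hle := pastEvents_le (measurable_iterate hn.measurable fun k => (hw0 k).1) i
  have heL : ∀ i, MemLp (e i) 2 P := fun i =>
    MemLp.of_eval fun k => (hwL i k).sub (memLp_const _)
  have hμsL : MemLp (fun ω k => μ k • s k ω) 2 P :=
    MemLp.of_eval fun k => (hsL k).1.const_smul (μ k)
  have hyL : MemLp y 2 P := (combine (E := E) A).comp_memLp' hμsL
  have hbint : ∀ (b : (n → E) →L[ℝ] (n → E) →L[ℝ] ℝ) {f : Ω → n → E}, MemLp f 2 P →
      Integrable (fun ω => b (f ω) (f ω)) P := fun b _ hf =>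
    memLp_one_iff_integrable.1 (b.memLp_of_bilin 1 hf hf)
  have hrec : ∀ ω, e (i + 1) ω = meanStep A μ J wstar (e i ω) - y ω := fun ω =>
    iterate_succ_sub hstar i ω
  have huL : MemLp (fun ω => meanStep A μ J wstar (e i ω)) 2 P := by
    refine ((heL (i + 1)).add hyL).ae_eq (ae_of_all _ fun ω => ?_)
    simp [hrec]
  have hcont : Continuous (meanStep A μ J wstar) := by
    refine (combine A).continuous.comp (continuous_pi fun k => ?_)
    exact (continuous_apply k).sub
      (((hJ k).comp (continuous_const.add (continuous_apply k))).const_smul (μ k))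
  have hum : StronglyMeasurable[pastEvents w i] fun ω => meanStep A μ J wstar (e i ω) :=
    hcont.comp_stronglyMeasurable
      ((stronglyMeasurable_pastEvents w i).sub stronglyMeasurable_const)
  have hy0 : condExp (pastEvents w i) P y =ᵐ[P] 0 := by
    have h0 : condExp (pastEvents w i) P (fun ω k => μ k • s k ω) =ᵐ[P] 0 := by
      refine condExp_stack_ae_eq_zero (hμsL.integrable one_le_two) fun k => ?_
      filter_upwards [condExp_smul (μ := P) (μ k) (s k) (pastEvents w i), hn.zero_mean k i]
        with ω h1 h2
      have h3 : condExp (pastEvents w i) P (s k) ω = 0 := h2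
      refine h1.trans ?_
      rw [Pi.smul_apply, h3, smul_zero]
      rfl
    filter_upwards [(combine (E := E) A).comp_condExp_comm (hμsL.integrable one_le_two)
      (m := pastEvents w i), h0] with ω h1 h2
    refine h1.symm.trans ?_
    simp [h2]
  -- The mean step is known at time `i` and the noise `y` is centered given that past.
  have hmain : ∫ ω, b (e (i + 1) ω) (e (i + 1) ω) ∂P =
      ∫ ω, b (meanStep A μ J wstar (e i ω)) (meanStep A μ J wstar (e i ω)) ∂P +
        ∫ ω, b (y ω) (y ω) ∂P := by
    simp only [hrec]
    exact integral_quadratic_sub hle b hum huL hyL hy0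
  have hdrift : ∫ ω, b (meanStep A μ J wstar (e i ω)) (meanStep A μ J wstar (e i ω)) ∂P ≤
      r * ∫ ω, b (e i ω) (e i ω) ∂P + κ := by
    have hint : Integrable (fun ω => r * b (e i ω) (e i ω) + κ) P :=
      ((hbint b (heL i)).const_mul r).add (integrable_const κ)
    refine (integral_mono (hbint b huL) hint fun ω => hdet (e i ω)).trans_eq ?_
    rw [integral_add ((hbint b (heL i)).const_mul r) (integrable_const κ), integral_const_mul]
    simp
  have hesq : Integrable (fun ω => ‖e i ω‖ ^ 2) P :=
    (memLp_two_iff_integrable_sq_norm (heL i).1).1 (heL i)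
  have hssq : ∀ k, Integrable (fun ω => ‖s k ω‖ ^ 2) P := fun k =>
    (memLp_two_iff_integrable_sq_norm (hsL k).1.1).1 (hsL k).1
  have hwsq : ∀ k, Integrable (fun ω => ‖w i k ω‖ ^ 2) P := fun k =>
    (memLp_two_iff_integrable_sq_norm (hwL i k).1).1 (hwL i k)
  have hsk : ∀ k, ∫ ω, ‖s k ω‖ ^ 2 ∂P ≤
      (2 * β k ^ 2 * (1 + ‖wstar‖ ^ 2) + σ k ^ 2) * (1 + ∫ ω, ‖e i ω‖ ^ 2 ∂P) := by
    intro k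
    have hwk : ∫ ω, ‖w i k ω‖ ^ 2 ∂P ≤ 2 * ‖wstar‖ ^ 2 + 2 * ∫ ω, ‖e i ω‖ ^ 2 ∂P := by
      have hpt : ∀ ω, ‖w i k ω‖ ^ 2 ≤ 2 * ‖wstar‖ ^ 2 + 2 * ‖e i ω‖ ^ 2 := by
        intro ω
        have h1 : ‖w i k ω‖ ≤ ‖wstar‖ + ‖e i ω‖ := by
          have h2 : w i k ω = wstar k + e i ω k := by simp [he_def]
          rw [h2]
          exact (norm_add_le _ _).trans (add_le_add (norm_le_pi_norm _ k) (norm_le_pi_norm _ k))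
        nlinarith [norm_nonneg (w i k ω), sq_nonneg (‖wstar‖ - ‖e i ω‖)]
      have hint : Integrable (fun ω => 2 * ‖wstar‖ ^ 2 + 2 * ‖e i ω‖ ^ 2) P :=
        (integrable_const _).add (hesq.const_mul 2)
      refine (integral_mono (hwsq k) hint hpt).trans_eq ?_
      rw [integral_add (integrable_const _) (hesq.const_mul 2)]
      simp [integral_const_mul]
    have he0 : 0 ≤ ∫ ω, ‖e i ω‖ ^ 2 ∂P := integral_nonneg fun ω => by positivity
    have h1 := mul_le_mul_of_nonneg_left hwk (sq_nonneg (β k))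
    nlinarith [(hsL k).2, mul_nonneg (sq_nonneg (σ k)) he0,
      mul_nonneg (mul_nonneg (sq_nonneg (β k)) (sq_nonneg ‖wstar‖)) he0, sq_nonneg (β k)]
  have hpty : ∀ ω, b (y ω) (y ω) ≤
      K * μmax ^ 2 * ∑ k, ‖s k ω‖ ^ 2 := by
    intro ω
    have hs : ‖fun k => μ k • s k ω‖ ^ 2 ≤ μmax ^ 2 * ∑ k, ‖s k ω‖ ^ 2 := by
      refine (sq_norm_le_stackInner _).trans ?_
      rw [stackInner_self, Finset.mul_sum]
      refine Finset.sum_le_sum fun k _ => ?_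
      rw [norm_smul, mul_pow, Real.norm_eq_abs]
      have := hμ k
      gcongr
    calc b (y ω) (y ω) ≤ K * ‖y ω‖ ^ 2 := hbK _
      _ ≤ K * ‖fun k => μ k • s k ω‖ ^ 2 := by
          have := hcomb fun k => μ k • s k ω
          gcongr
      _ ≤ K * (μmax ^ 2 * ∑ k, ‖s k ω‖ ^ 2) := by gcongr
      _ = _ := by ring
  have hec : ∫ ω, ‖e i ω‖ ^ 2 ∂P ≤ c * ∫ ω, b (e i ω) (e i ω) ∂P := by
    rw [← integral_const_mul]
    exact integral_mono hesq ((hbint b (heL i)).const_mul c) fun ω => hc (e i ω)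
  have hnoise : ∫ ω, b (y ω) (y ω) ∂P ≤ K * μmax ^ 2 *
      ((∑ k, (2 * β k ^ 2 * (1 + ‖wstar‖ ^ 2) + σ k ^ 2)) *
        (1 + c * ∫ ω, b (e i ω) (e i ω) ∂P)) := by
    refine (integral_mono (hbint b hyL)
      ((integrable_finsetSum _ fun k _ => hssq k).const_mul _) hpty).trans ?_
    rw [integral_const_mul, integral_finsetSum _ fun k _ => hssq k, Finset.sum_mul]
    gcongr with k _
    refine (hsk k).trans ?_
    gcongr
  linarith [hmain, hdrift, hnoise]

theorem lintegral_sq_error_le (hn : NoiseConditions P J gHat (iterate A μ gHat w0) β σ)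
    (hJ : ∀ k, Continuous (∇ (J k))) {δ : ℝ} (hδ : ∀ k x, ‖∇ (J k) x‖ ≤ ‖∇ (J k) 0‖ + δ * ‖x‖)
    (hw0 : ∀ k, Measurable (w0 k) ∧ MemLp (w0 k) 2 P) {wstar : n → E}
    {b : (n → E) →L[ℝ] (n → E) →L[ℝ] ℝ} {c : ℝ} (hc : ∀ x, ‖x‖ ^ 2 ≤ c * b x x) (i : ℕ) (k : n) :
    ∫⁻ ω, ‖wstar k - iterate A μ gHat w0 i k ω‖ₑ ^ 2 ∂P ≤
      ENNReal.ofReal (c * ∫ ω, b ((fun k => iterate A μ gHat w0 i k ω) - wstar)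
        ((fun k => iterate A μ gHat w0 i k ω) - wstar) ∂P) := by
  have heL : MemLp (fun ω => (fun k => iterate A μ gHat w0 i k ω) - wstar) 2 P :=
    MemLp.of_eval fun k => (memLp_iterate hn hJ hδ hw0 i k).sub (memLp_const _)
  have hint : Integrable (fun ω => b ((fun k => iterate A μ gHat w0 i k ω) - wstar)
      ((fun k => iterate A μ gHat w0 i k ω) - wstar)) P :=
    memLp_one_iff_integrable.1 (b.memLp_of_bilin 1 heL heL)
  rw [← integral_const_mul, ofReal_integral_eq_lintegral_ofReal (hint.const_mul c)
    (ae_of_all _ fun ω => (sq_nonneg _).trans (hc _))]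
  refine lintegral_mono fun ω => ?_
  rw [← ofReal_norm, ← ENNReal.ofReal_pow (norm_nonneg _), norm_sub_rev]
  refine ENNReal.ofReal_le_ofReal (le_trans ?_ (hc _))
  exact pow_le_pow_left₀ (norm_nonneg _)
    (norm_le_pi_norm ((fun k => iterate A μ gHat w0 i k ω) - wstar) k) 2

end Diffusion

/-- A geometric recursion with contraction factor `1 - r` and forcing `κ` settles below `κ / r`. -/
theorem limsup_le_of_recursion {u : ℕ → ℝ} {x : ℕ → ℝ≥0∞} {r κ c : ℝ} (hr : 0 < r) (hr1 : r ≤ 1)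
    (hc : 0 ≤ c) (hu : ∀ i, u (i + 1) ≤ (1 - r) * u i + κ)
    (hx : ∀ i, x i ≤ ENNReal.ofReal (c * u i)) :
    limsup x atTop ≤ ENNReal.ofReal (c * (κ / r)) := by
  have hbound : ∀ i, u i ≤ (1 - r) ^ i * (u 0 - κ / r) + κ / r := by
    intro i
    induction i with
    | zero => simp
    | succ i ih =>
      have h1 := mul_le_mul_of_nonneg_left ih (sub_nonneg.2 hr1)
      have h2 : r * (κ / r) = κ := mul_div_cancel₀ κ hr.ne'
      refine (hu i).trans ?_
      rw [pow_succ]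
      nlinarith
  have hlim : Tendsto (fun i => ENNReal.ofReal (c * ((1 - r) ^ i * (u 0 - κ / r) + κ / r))) atTop
      (nhds (ENNReal.ofReal (c * (κ / r)))) := by
    refine ENNReal.tendsto_ofReal ?_
    have h1 := (tendsto_pow_atTop_nhds_zero_of_lt_one (sub_nonneg.2 hr1)
      (by linarith : 1 - r < 1)).mul_const (u 0 - κ / r)
    simpa using (h1.add_const (κ / r)).const_mul c
  rw [← hlim.limsup_eq]
  refine limsup_le_limsup (Eventually.of_forall fun i => (hx i).trans ?_)
  exact ENNReal.ofReal_le_ofReal (mul_le_mul_of_nonneg_left (hbound i) hc)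

/-! ### Decrease of the Lyapunov function along the noiseless recursion -/

section Estimates

/-- Young's inequality for a nonnegative quadratic form. -/
theorem quadratic_sub_le {X : Type*} [NormedAddCommGroup X] [NormedSpace ℝ X]
    {b : X →L[ℝ] X →L[ℝ] ℝ} (hb : ∀ x, 0 ≤ b x x) (x y : X) {η : ℝ} (hη : 0 < η) :
    b (x - y) (x - y) ≤ (1 + η) * b x x + (1 + 1 / η) * b y y := by
  have h := hb (η • x + y)
  simp only [map_add, map_smul, map_sub, add_apply, sub_apply, smul_apply,
    smul_eq_mul] at h ⊢
  have h2 : 0 ≤ (1 / η) * (η * (η * b x x + b x y) + (η * b y x + b y y)) :=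
    mul_nonneg (by positivity) (by linarith)
  have h3 : (1 / η) * (η * (η * b x x + b x y) + (η * b y x + b y y)) =
      η * b x x + b x y + b y x + 1 / η * b y y := by
    field_simp
    ring
  linarith

/-- The bounds for the centroids (`C`) and for the deviation (`q`) add up to a common decrease: the
terms of order `μ q` are absorbed by the loss `ε ^ 2 * q`, which does not depend on `μ`. -/
theorem combined_decrease_le {N D a ε κ l μ C q t : ℝ} (hN : 0 ≤ N) (hl : 0 ≤ l) (hD : 0 ≤ D)
    (hκ : 0 ≤ κ) (hμ : 0 ≤ μ) (hμ1 : μ ≤ 1) (hC : 0 ≤ C) (ht0 : 0 ≤ t) (ht : t ≤ q)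
    (h1 : μ * (2 * (D + κ + 1)) ≤ a) (h2 : μ * (N * (l + D) + κ + a / 2) ≤ ε ^ 2)
    (hq : 0 ≤ q) :
    (1 - a * μ + D * μ ^ 2) * C + N * ((μ * l + D * μ ^ 2) * t) +
      ((1 - ε ^ 2) * q + κ * μ ^ 2 * (1 + (C + q))) ≤ (1 - a / 2 * μ) * (C + q) + κ * μ ^ 2 := by
  have hμμ : μ ^ 2 ≤ μ := by nlinarith
  have h3 : N * ((μ * l + D * μ ^ 2) * t) ≤ μ * (N * (l + D)) * q := by
    calc _ ≤ N * ((μ * l + D * μ) * q) := by gcongr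
      _ = _ := by ring
  have h4 : κ * μ ^ 2 * q ≤ κ * μ * q := by gcongr
  have h5 : (D + κ) * μ ^ 2 * C ≤ a / 2 * μ * C := by
    refine mul_le_mul_of_nonneg_right ?_ hC
    nlinarith
  have h6 := mul_le_mul_of_nonneg_right h2 hq
  linarith

variable {E : Type*} [NormedAddCommGroup E] [InnerProductSpace ℝ E]

/-- A gradient step with direction `h + r`, where `h` is strongly monotone and Lipschitz in `c` and
`r` is a perturbation. -/
theorem sq_norm_sub_smul_le {c h r : E} {a δ t μ : ℝ} (ha : 0 < a) (hμ : 0 ≤ μ)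
    (hmono : a * ‖c‖ ^ 2 ≤ inner ℝ h c) (hh : ‖h‖ ≤ δ * ‖c‖) (hr : ‖r‖ ≤ δ * t) :
    ‖c - μ • (h + r)‖ ^ 2 ≤
      (1 - a * μ + 2 * δ ^ 2 * μ ^ 2) * ‖c‖ ^ 2 +
        (μ * (δ ^ 2 / a) + 2 * δ ^ 2 * μ ^ 2) * t ^ 2 := by
  have h1 : inner ℝ c (μ • (h + r)) = μ * (inner ℝ h c + inner ℝ r c) := by
    rw [real_inner_smul_right, inner_add_right, real_inner_comm h, real_inner_comm r]
  have h2 : -(δ * t * ‖c‖) ≤ inner ℝ r c := by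
    have h3 := neg_le_of_abs_le (abs_real_inner_le_norm r c)
    have h4 := mul_le_mul_of_nonneg_right hr (norm_nonneg c)
    linarith
  have h3 : ‖h + r‖ ^ 2 ≤ 2 * δ ^ 2 * (‖c‖ ^ 2 + t ^ 2) := by
    have h4 : ‖h + r‖ ≤ δ * ‖c‖ + δ * t := (norm_add_le _ _).trans (add_le_add hh hr)
    have h5 := pow_le_pow_left₀ (norm_nonneg (h + r)) h4 2
    nlinarith [sq_nonneg (δ * ‖c‖ - δ * t)]
  -- The cross term is split so that it costs only half of the gain `2 * a * ‖c‖ ^ 2`.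
  have h4 : 2 * (δ * t * ‖c‖) ≤ a * ‖c‖ ^ 2 + δ ^ 2 / a * t ^ 2 := by
    have h5 : 0 ≤ (a * ‖c‖ - δ * t) ^ 2 / a := by positivity
    have h6 : (a * ‖c‖ - δ * t) ^ 2 / a =
        a * ‖c‖ ^ 2 - 2 * (δ * t * ‖c‖) + δ ^ 2 / a * t ^ 2 := by
      field_simp
      ring
    linarith
  rw [norm_sub_sq_real, h1, norm_smul, Real.norm_of_nonneg hμ]
  have h5 := mul_le_mul_of_nonneg_left h3 (sq_nonneg μ)
  have h6 := mul_le_mul_of_nonneg_left (add_le_add hmono h2) hμ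
  have h7 := mul_le_mul_of_nonneg_left h4 hμ
  nlinarith

end Estimates

section Network

variable {S R : ℕ} {NS : Fin S → ℕ} {NR : Fin R → ℕ} {A : Matrix (Agent NS NR) (Agent NS NR) ℝ}
  {E : Type*} [NormedAddCommGroup E] [InnerProductSpace ℝ E]

/-- The difference between a stacked vector and the one spread from its centroids. It has zero
centroids, and it commutes with the combination step. -/
noncomputable def deviation (A : Matrix (Agent NS NR) (Agent NS NR) ℝ)
    (p : (s : Fin S) → Fin (NS s) → ℝ) : (Agent NS NR → E) →L[ℝ] (Agent NS NR → E) :=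
  ContinuousLinearMap.id ℝ _ - (spread A).comp (centroid NR p)

theorem deviation_apply (p : (s : Fin S) → Fin (NS s) → ℝ) (x : Agent NS NR → E) :
    deviation A p x = x - spread A (centroid NR p x) := rfl

theorem centroid_deviation {p : (s : Fin S) → Fin (NS s) → ℝ} (hp : ∀ s, ∑ k, p s k = 1)
    (x : Agent NS NR → E) : centroid NR p (deviation A p x) = 0 := by
  rw [deviation_apply, map_sub, centroid_spread hp, sub_self]

theorem IsWeaklyConnected.deviation_combine (hA : IsWeaklyConnected A)
    {p : (s : Fin S) → Fin (NS s) → ℝ} (hp : ∀ s, IsPerronVector (sendBlock A s) (p s))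
    (x : Agent NS NR → E) : deviation A p (combine A x) = combine A (deviation A p x) := by
  rw [deviation_apply, deviation_apply, hA.centroid_combine hp, map_sub, hA.combine_spread]

/-- The centroid of a sending sub-network makes a gradient step on its aggregate cost, perturbed by
the disagreement of its agents. -/
theorem sq_norm_centroid_sub_le [CompleteSpace E] {J : Agent NS NR → E → ℝ}
    {τ : Agent NS NR → ℝ} (hτ : ∀ k, 0 < τ k ∧ τ k ≤ 1) {p : (s : Fin S) → Fin (NS s) → ℝ}
    (hp : ∀ s, IsPerronVector (sendBlock A s) (p s)) {δ : ℝ} (hδ : 0 ≤ δ)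
    (hLip : ∀ k x y, ‖∇ (J k) x - ∇ (J k) y‖ ≤ δ * ‖x - y‖) {wS : Fin S → E} {a : ℝ} (ha : 0 < a)
    (hzero : ∀ s, ∑ k, (τ (Sum.inl ⟨s, k⟩) * p s k) • ∇ (J (Sum.inl ⟨s, k⟩)) (wS s) = 0)
    (hmono : ∀ s x, a * ‖x‖ ^ 2 ≤
      inner ℝ (∑ k, (τ (Sum.inl ⟨s, k⟩) * p s k) • ∇ (J (Sum.inl ⟨s, k⟩)) (wS s + x)) x)
    {μ : ℝ} (hμ : 0 ≤ μ) (x : Agent NS NR → E) (s : Fin S) :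
    ‖centroid NR p (x - μ • fun k => τ k • ∇ (J k) (spread A wS k + x k)) s‖ ^ 2 ≤
      (1 - a * μ + 2 * δ ^ 2 * μ ^ 2) * ‖centroid NR p x s‖ ^ 2 +
        (μ * (δ ^ 2 / a) + 2 * δ ^ 2 * μ ^ 2) * ‖deviation A p x‖ ^ 2 := by
  set c := centroid NR p x with hc
  set d := deviation A p x with hd
  have hw : ∀ k : Fin (NS s), 0 ≤ τ (Sum.inl ⟨s, k⟩) * p s k := fun k =>
    mul_nonneg (hτ _).1.le ((hp s).2.2 k).le
  have hwsum : ∑ k, τ (Sum.inl ⟨s, k⟩) * p s k ≤ 1 := by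
    rw [← (hp s).2.1]
    exact Finset.sum_le_sum fun k _ => mul_le_of_le_one_left ((hp s).2.2 k).le (hτ _).2
  have hwnorm : ∀ (v : Fin (NS s) → E) (t : ℝ), 0 ≤ t → (∀ k, ‖v k‖ ≤ t) →
      ‖∑ k, (τ (Sum.inl ⟨s, k⟩) * p s k) • v k‖ ≤ t := by
    intro v t ht hv
    calc _ ≤ ∑ k, (τ (Sum.inl ⟨s, k⟩) * p s k) * t := norm_sum_le_of_le _ fun k _ => by
          rw [norm_smul, Real.norm_of_nonneg (hw k)]
          exact mul_le_mul_of_nonneg_left (hv k) (hw k)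
      _ ≤ 1 * t := by
          rw [← Finset.sum_mul]
          exact mul_le_mul_of_nonneg_right hwsum ht
      _ = t := one_mul t
  have hx : ∀ k, x (Sum.inl ⟨s, k⟩) = c s + d (Sum.inl ⟨s, k⟩) := by
    intro k
    simp [hd, hc, deviation_apply, spread_inl]
  set h := ∑ k, (τ (Sum.inl ⟨s, k⟩) * p s k) • ∇ (J (Sum.inl ⟨s, k⟩)) (wS s + c s) with hh
  set r := ∑ k, (τ (Sum.inl ⟨s, k⟩) * p s k) •
    (∇ (J (Sum.inl ⟨s, k⟩)) (wS s + x (Sum.inl ⟨s, k⟩)) - ∇ (J (Sum.inl ⟨s, k⟩)) (wS s + c s))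
    with hr
  have hstep : centroid NR p (x - μ • fun k => τ k • ∇ (J k) (spread A wS k + x k)) s =
      c s - μ • (h + r) := by
    have hsum : centroid NR p (fun k => τ k • ∇ (J k) (spread A wS k + x k)) s = h + r := by
      rw [centroid_apply, hh, hr, ← Finset.sum_add_distrib]
      refine Finset.sum_congr rfl fun k _ => ?_
      rw [← smul_add, add_sub_cancel, smul_smul, mul_comm, spread_inl]
    rw [map_sub, map_smul, Pi.sub_apply, Pi.smul_apply, hsum]
  rw [hstep]
  refine sq_norm_sub_smul_le ha hμ (hmono s (c s)) ?_ ?_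
  · have h0 : h = ∑ k, (τ (Sum.inl ⟨s, k⟩) * p s k) •
        (∇ (J (Sum.inl ⟨s, k⟩)) (wS s + c s) - ∇ (J (Sum.inl ⟨s, k⟩)) (wS s)) := by
      simp only [smul_sub, Finset.sum_sub_distrib, hzero, sub_zero, hh]
    rw [h0]
    refine hwnorm _ _ (by positivity) fun k => (hLip _ _ _).trans_eq ?_
    rw [add_sub_cancel_left]
  · refine hwnorm _ _ (by positivity) fun k => (hLip _ _ _).trans ?_
    rw [add_sub_add_left_eq_sub, hx, add_sub_cancel_left]
    exact mul_le_mul_of_nonneg_left (norm_le_pi_norm d _) hδ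

/-- The Lyapunov function: the squared centroids plus the quadratic form of the deviation. For
small step-sizes the noiseless recursion decreases it by a factor `1 - r μ`, up to `K μ ^ 2`. -/
theorem IsWeaklyConnected.exists_lyapunov_meanStep [CompleteSpace E] (hA : IsWeaklyConnected A)
    {J : Agent NS NR → E → ℝ} {τ : Agent NS NR → ℝ} (hτ : ∀ k, 0 < τ k ∧ τ k ≤ 1)
    {p : (s : Fin S) → Fin (NS s) → ℝ} (hp : ∀ s, IsPerronVector (sendBlock A s) (p s))
    {δ : ℝ} (hδ : 0 ≤ δ) (hLip : ∀ k x y, ‖∇ (J k) x - ∇ (J k) y‖ ≤ δ * ‖x - y‖)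
    {wS : Fin S → E} {a : ℝ} (ha : 0 < a)
    (hzero : ∀ s, ∑ k, (τ (Sum.inl ⟨s, k⟩) * p s k) • ∇ (J (Sum.inl ⟨s, k⟩)) (wS s) = 0)
    (hmono : ∀ s x, a * ‖x‖ ^ 2 ≤
      inner ℝ (∑ k, (τ (Sum.inl ⟨s, k⟩) * p s k) • ∇ (J (Sum.inl ⟨s, k⟩)) (wS s + x)) x) :
    ∃ (b : (Agent NS NR → E) →L[ℝ] (Agent NS NR → E) →L[ℝ] ℝ) (Kb c μ₀ r K : ℝ),
      0 ≤ Kb ∧ (∀ x, b x x ≤ Kb * ‖x‖ ^ 2) ∧ 0 ≤ c ∧ (∀ x, ‖x‖ ^ 2 ≤ c * b x x) ∧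
      0 < μ₀ ∧ 0 < r ∧ 0 ≤ K ∧ ∀ μ, 0 < μ → μ < μ₀ → ∀ x,
        b (meanStep A (stepSize τ μ) J (spread A wS) x)
          (meanStep A (stepSize τ μ) J (spread A wS) x) ≤ (1 - r * μ) * b x x + K * μ ^ 2 := by
  have hp1 : ∀ s, ∑ k, p s k = 1 := fun s => (hp s).2.1
  obtain ⟨m, ρ, hρ0, hρ1, hρ⟩ := hA.exists_norm_combine_pow_le (E := E) hp
  obtain ⟨Q, KQ, ε, hKQ, hε0, hε1, hQlow, hQup, hQdec⟩ := exists_lyapunov_form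
    (T := combine (E := E) A) (norm_combine_le hA.nonneg hA.colSum)
    (U := {x | centroid NR p x = 0}) (fun x hx => (hA.centroid_combine hp x).trans hx) hρ0 hρ1 hρ
  obtain ⟨Cc, hCc0, hCc⟩ := (centroid (E := E) NR p).bound
  obtain ⟨Cd, hCd0, hCd⟩ := (deviation (E := E) A p).bound
  obtain ⟨z, hz0, hz⟩ := (spread (E := E) A).bound
  have hQ0 : ∀ x, 0 ≤ Q x x := fun x => (sq_nonneg _).trans (hQlow x)
  set b : (Agent NS NR → E) →L[ℝ] (Agent NS NR → E) →L[ℝ] ℝ :=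
    (stackInner (Fin S) E).bilinearComp (centroid NR p) (centroid NR p) +
      Q.bilinearComp (deviation A p) (deviation A p) with hb_def
  have hb : ∀ x, b x x = ∑ s, ‖centroid NR p x s‖ ^ 2 + Q (deviation A p x) (deviation A p x) :=
    fun x => by rw [← stackInner_self]; rfl
  have hsum0 : ∀ x : Agent NS NR → E, 0 ≤ ∑ s, ‖centroid NR p x s‖ ^ 2 := fun x =>
    Finset.sum_nonneg fun s _ => sq_nonneg _
  set c : ℝ := 2 * (z ^ 2 + 1) with hc_def
  have hlow : ∀ x, ‖x‖ ^ 2 ≤ c * b x x := by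
    intro x
    have h1 : ‖x‖ ≤ z * ‖centroid NR p x‖ + ‖deviation A p x‖ := by
      calc ‖x‖ = ‖spread A (centroid NR p x) + deviation A p x‖ := by
            rw [deviation_apply, add_sub_cancel]
        _ ≤ _ := (norm_add_le _ _).trans (by gcongr; exact hz _)
    have h2 : ‖centroid NR p x‖ ^ 2 ≤ ∑ s, ‖centroid NR p x s‖ ^ 2 := by
      rw [← stackInner_self]
      exact sq_norm_le_stackInner _
    have h3 := hQlow (deviation A p x)
    have h4 := pow_le_pow_left₀ (norm_nonneg x) h1 2
    have h5 := mul_le_mul_of_nonneg_left h2 (sq_nonneg z)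
    have h6 := mul_nonneg (sq_nonneg z) (hQ0 (deviation A p x))
    rw [hb, hc_def]
    nlinarith [sq_nonneg (z * ‖centroid NR p x‖ - ‖deviation A p x‖), hsum0 x]
  set g₀ : ℝ := ‖fun k => ∇ (J k) (spread A wS k)‖ with hg₀
  set K₁ : ℝ := KQ * Cd ^ 2 * (2 * g₀ ^ 2 + 2 * δ ^ 2 * c) with hK₁
  have hc0 : 0 ≤ c := by positivity
  have hK₁0 : 0 ≤ K₁ := by positivity
  -- The drift direction `D` grows linearly, so its contribution to the form is of the order of
  -- the form itself.
  have hD : ∀ x, Q (deviation A p fun k => τ k • ∇ (J k) (spread A wS k + x k))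
      (deviation A p fun k => τ k • ∇ (J k) (spread A wS k + x k)) ≤ K₁ * (1 + b x x) := by
    intro x
    set D : Agent NS NR → E := fun k => τ k • ∇ (J k) (spread A wS k + x k) with hD_def
    have hb0 : 0 ≤ b x x := by
      rw [hb]
      exact add_nonneg (hsum0 x) (hQ0 _)
    have h1 : ‖D‖ ≤ g₀ + δ * ‖x‖ := by
      refine (pi_norm_le_iff_of_nonneg (by positivity)).2 fun k => ?_
      have h2 : ‖∇ (J k) (spread A wS k + x k)‖ ≤ g₀ + δ * ‖x‖ := by
        have h3 := hLip k (spread A wS k + x k) (spread A wS k)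
        rw [add_sub_cancel_left] at h3
        have h4 := norm_le_pi_norm (fun k => ∇ (J k) (spread A wS k)) k
        have h5 := norm_le_norm_add_norm_sub' (∇ (J k) (spread A wS k + x k))
          (∇ (J k) (spread A wS k))
        have h6 := mul_le_mul_of_nonneg_left (norm_le_pi_norm x k) hδ
        exact h5.trans (add_le_add h4 (h3.trans h6))
      rw [hD_def, norm_smul, Real.norm_of_nonneg (hτ k).1.le]
      exact (mul_le_of_le_one_left (norm_nonneg _) (hτ k).2).trans h2
    have h2 : ‖D‖ ^ 2 ≤ 2 * g₀ ^ 2 + 2 * δ ^ 2 * (c * b x x) := by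
      have h3 := pow_le_pow_left₀ (norm_nonneg D) h1 2
      have h4 := mul_le_mul_of_nonneg_left (hlow x) (sq_nonneg δ)
      nlinarith [sq_nonneg (g₀ - δ * ‖x‖)]
    calc _ ≤ KQ * ‖deviation A p D‖ ^ 2 := hQup _
      _ ≤ KQ * (Cd * ‖D‖) ^ 2 := by
          have := hCd D
          gcongr
      _ = KQ * Cd ^ 2 * ‖D‖ ^ 2 := by ring
      _ ≤ KQ * Cd ^ 2 * ((2 * g₀ ^ 2 + 2 * δ ^ 2 * c) * (1 + b x x)) := by
          refine mul_le_mul_of_nonneg_left (h2.trans ?_) (by positivity)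
          have h5 : 0 ≤ g₀ ^ 2 * b x x := by positivity
          have h6 : 0 ≤ δ ^ 2 * c := by positivity
          nlinarith
      _ = _ := by ring
  set K₂ : ℝ := 2 * δ ^ 2 + K₁ / ε with hK₂
  set K₃ : ℝ := S * (δ ^ 2 / a + 2 * δ ^ 2) + K₁ / ε with hK₃
  have hK₁ε : 0 ≤ K₁ / ε := by positivity
  have hK₂0 : 0 ≤ K₂ := by positivity
  have hK₃0 : 0 ≤ K₃ := by positivity
  -- The three bounds on the step-size give `μ ^ 2 ≤ μ`, let the drift of the centroids beat the
  -- terms of order `μ ^ 2`, and let the fixed loss `ε ^ 2` of the deviation beat those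
  -- of order `μ`.
  refine ⟨b, (S + 1) * Cc ^ 2 + KQ * Cd ^ 2, c,
    min 1 (min (a / (2 * (K₂ + 1))) (ε ^ 2 / (K₃ + a / 2))), a / 2, K₁ / ε, by positivity, ?_, hc0,
    hlow, by positivity, by positivity, hK₁ε, ?_⟩
  · intro x
    have h1 : ∑ s, ‖centroid NR p x s‖ ^ 2 ≤ (S + 1) * (Cc * ‖x‖) ^ 2 := by
      rw [← stackInner_self]
      refine (stackInner_le_sq_norm _).trans ?_
      rw [Fintype.card_fin]
      have := hCc x
      gcongr
    have h2 : Q (deviation A p x) (deviation A p x) ≤ KQ * (Cd * ‖x‖) ^ 2 := by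
      refine (hQup _).trans ?_
      have := hCd x
      gcongr
    rw [hb]
    linarith
  · intro μ hμ hμlt x
    obtain ⟨hμ1, hμlt⟩ := lt_min_iff.1 hμlt
    obtain ⟨hμ2, hμ3⟩ := lt_min_iff.1 hμlt
    rw [lt_div_iff₀ (by positivity)] at hμ2 hμ3
    set D : Agent NS NR → E := fun k => τ k • ∇ (J k) (spread A wS k + x k) with hD_def
    have hstep : meanStep A (stepSize τ μ) J (spread A wS) x = combine A (x - μ • D) := by
      rw [meanStep]
      congr 1
      funext k
      simp [hD_def, stepSize, smul_smul, mul_comm]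
    have hcen : ∑ s, ‖centroid NR p (x - μ • D) s‖ ^ 2 ≤
        (1 - a * μ + 2 * δ ^ 2 * μ ^ 2) * ∑ s, ‖centroid NR p x s‖ ^ 2 +
          S * ((μ * (δ ^ 2 / a) + 2 * δ ^ 2 * μ ^ 2) * ‖deviation A p x‖ ^ 2) := by
      refine (Finset.sum_le_sum fun s _ =>
        sq_norm_centroid_sub_le hτ hp hδ hLip ha hzero hmono hμ.le x s).trans_eq ?_
      rw [Finset.sum_add_distrib, ← Finset.mul_sum]
      simp
    have hdev : Q (combine A (deviation A p (x - μ • D))) (combine A (deviation A p (x - μ • D))) ≤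
        (1 - ε ^ 2) * Q (deviation A p x) (deviation A p x) + K₁ / ε * μ ^ 2 * (1 + b x x) := by
      have h1 := hQdec (deviation A p (x - μ • D)) (centroid_deviation hp1 _)
      have h2 := quadratic_sub_le hQ0 (deviation A p x) (μ • deviation A p D) hε0
      rw [← map_smul, ← map_sub] at h2
      have h3 : Q (deviation A p (μ • D)) (deviation A p (μ • D)) ≤ μ ^ 2 * (K₁ * (1 + b x x)) := by
        simp only [map_smul, smul_apply, smul_eq_mul]
        have := mul_le_mul_of_nonneg_left (hD x) (sq_nonneg μ)
        linarith
      have h4 := mul_le_mul_of_nonneg_left h2 (sub_nonneg.2 hε1)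
      have h5 : (1 - ε) * (1 + 1 / ε) ≤ 1 / ε := by
        have : (1 - ε) * (1 + 1 / ε) = 1 / ε - ε := by
          field_simp
          ring
        linarith
      have h6 := mul_le_mul h5 h3 (hQ0 _) (by positivity)
      calc _ ≤ _ := h1.trans h4
        _ = (1 - ε ^ 2) * Q (deviation A p x) (deviation A p x) +
            (1 - ε) * (1 + 1 / ε) * Q (deviation A p (μ • D)) (deviation A p (μ • D)) := by ring
        _ ≤ _ := by
            refine add_le_add le_rfl (h6.trans_eq ?_)
            ring
    rw [hstep, hb, hA.centroid_combine hp, hA.deviation_combine hp]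
    refine (add_le_add hcen hdev).trans ?_
    have hd := hQlow (deviation A p x)
    have hC := hsum0 x
    have hq := hQ0 (deviation A p x)
    rw [hb]
    exact combined_decrease_le (Nat.cast_nonneg S) (by positivity) (by positivity) hK₁ε hμ.le
      hμ1.le hC (sq_nonneg _) hd (by rw [hK₂] at hμ2; linarith)
      (by rw [hK₃] at hμ3; linarith) hq

end Network

/-! ### Pareto solutions and mean-square stability -/

theorem norm_gradient_sub_le {E : Type*} [NormedAddCommGroup E] [InnerProductSpace ℝ E]
    [CompleteSpace E] {f : E → ℝ} (hd : Differentiable ℝ (∇ f)) {δ : ℝ}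
    (hδ : ∀ v, ‖fderiv ℝ (∇ f) v‖ ≤ δ) (x y : E) : ‖∇ f x - ∇ f y‖ ≤ δ * ‖x - y‖ :=
  convex_univ.norm_image_sub_le_of_norm_fderiv_le (fun v _ => hd v) (fun v _ => hδ v)
    (mem_univ y) (mem_univ x)

/-- The aggregate cost is `μmax` times a function that does not depend on `μmax`, so its minimizers
do not depend on `μmax` either. -/
theorem isMinOn_aggregateCost_iff {S R M : ℕ} {NS : Fin S → ℕ} {NR : Fin R → ℕ}
    {J : Agent NS NR → EuclideanSpace ℝ (Fin M) → ℝ} {τ : Agent NS NR → ℝ} {μmax : ℝ}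
    (hμ : 0 < μmax) (s : Fin S) (p : Fin (NS s) → ℝ) (v : EuclideanSpace ℝ (Fin M)) :
    IsMinOn (aggregateCost J (stepSize τ μmax) s p) univ v ↔
      IsMinOn (fun x => ∑ k, (τ (Sum.inl ⟨s, k⟩) * p k) * J (Sum.inl ⟨s, k⟩) x) univ v := by
  have h : ∀ x, aggregateCost J (stepSize τ μmax) s p x =
      μmax * ∑ k, (τ (Sum.inl ⟨s, k⟩) * p k) * J (Sum.inl ⟨s, k⟩) x := by
    intro x
    rw [aggregateCost, Finset.mul_sum]
    exact Finset.sum_congr rfl fun k _ => by rw [stepSize]; ring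
  simp only [isMinOn_iff, h, mul_le_mul_iff_right₀ hμ]

/-- Each sending sub-network has a Pareto solution; the gradient of its aggregate cost vanishes
there and is strongly monotone around it, with a common modulus. -/
theorem exists_pareto {S R M : ℕ} {NS : Fin S → ℕ} {NR : Fin R → ℕ}
    {J : Agent NS NR → EuclideanSpace ℝ (Fin M) → ℝ} (hJ_diff : ∀ k, Differentiable ℝ (J k))
    (hJ_conv : ∀ k, ConvexOn ℝ univ (J k))
    (hJ_strong : ∀ s : Fin S, ∃ k : Fin (NS s), ∃ ν : ℝ, 0 < ν ∧
      StrongConvexOn univ ν (J (Sum.inl ⟨s, k⟩)))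
    {τ : Agent NS NR → ℝ} (hτ : ∀ k, 0 < τ k) {p : (s : Fin S) → Fin (NS s) → ℝ}
    (hp : ∀ s k, 0 < p s k) :
    ∃ (wS : Fin S → EuclideanSpace ℝ (Fin M)) (a : ℝ), 0 < a ∧
      (∀ s v, IsMinOn (fun x => ∑ k, (τ (Sum.inl ⟨s, k⟩) * p s k) * J (Sum.inl ⟨s, k⟩) x) univ v ↔
        v = wS s) ∧
      (∀ s, ∑ k, (τ (Sum.inl ⟨s, k⟩) * p s k) • ∇ (J (Sum.inl ⟨s, k⟩)) (wS s) = 0) ∧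
      ∀ s x, a * ‖x‖ ^ 2 ≤
        inner ℝ (∑ k, (τ (Sum.inl ⟨s, k⟩) * p s k) • ∇ (J (Sum.inl ⟨s, k⟩)) (wS s + x)) x := by
  have hq : ∀ s (k : Fin (NS s)), 0 < τ (Sum.inl ⟨s, k⟩) * p s k := fun s k =>
    mul_pos (hτ _) (hp s k)
  choose a ha hsupp using fun s => exists_sum_support
    (f := fun k : Fin (NS s) => J (Sum.inl ⟨s, k⟩)) (fun k => hJ_diff _) (fun k => hJ_conv _)
    (hq s) (hJ_strong s)
  choose wS hzero hmin using fun s => exists_unique_isMinOn_of_support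
    (F := fun x => ∑ k, (τ (Sum.inl ⟨s, k⟩) * p s k) * J (Sum.inl ⟨s, k⟩) x)
    (continuous_finsetSum _ fun k _ => (hJ_diff _).continuous.const_mul _) (ha s) (hsupp s)
    (fun v hv => sum_smul_gradient_eq_zero_of_isMinOn (fun k => hJ_diff _) hv)
  have hev : ∀ᶠ a₀ : ℝ in nhdsWithin 0 (Ioi 0), ∀ s, a₀ ≤ a s := eventually_all.2 fun s =>
    
    mem_of_superset (Ioo_mem_nhdsGT (ha s)) fun _ h => h.2.le
  obtain ⟨a₀, hle, hpos⟩ := (hev.and self_mem_nhdsWithin).exists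
  refine ⟨wS, a₀, hpos, hmin, hzero, fun s x => ?_⟩
  have h := inner_sub_ge_of_support (hsupp s) (wS s + x) (wS s)
  rw [hzero, sub_zero, add_sub_cancel_left] at h
  exact (mul_le_mul_of_nonneg_right (hle s) (sq_nonneg _)).trans h

end WeakNet

theorem mainTheorem1 {S R M : ℕ} {NS : Fin S → ℕ} {NR : Fin R → ℕ}
    (A : Matrix (WeakNet.Agent NS NR) (WeakNet.Agent NS NR) ℝ)
    (hA : WeakNet.IsWeaklyConnected A)
    (J : WeakNet.Agent NS NR → EuclideanSpace ℝ (Fin M) → ℝ)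
    (hJ_diff : ∀ k, Differentiable ℝ (J k))
    (hJ_diff2 : ∀ k, Differentiable ℝ (gradient (J k)))
    (hJ_conv : ∀ k, ConvexOn ℝ Set.univ (J k))
    (hJ_strong : ∀ s : Fin S, ∃ k : Fin (NS s), ∃ ν : ℝ, 0 < ν ∧
      StrongConvexOn Set.univ ν (J (Sum.inl ⟨s, k⟩)))
    (δ : ℝ) (hJ_hess : ∀ k v, ‖fderiv ℝ (gradient (J k)) v‖ ≤ δ)
    (τ : WeakNet.Agent NS NR → ℝ) (hτ : ∀ k, 0 < τ k ∧ τ k ≤ 1)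
    (β σ : WeakNet.Agent NS NR → ℝ) :
    -- the objects that define the limit points are well defined
    (∀ s, ∃! p : Fin (NS s) → ℝ, WeakNet.IsPerronVector (WeakNet.sendBlock A s) p) ∧
    IsUnit (1 - WeakNet.TRR A) ∧
    ∀ p : (s : Fin S) → Fin (NS s) → ℝ,
      (∀ s, WeakNet.IsPerronVector (WeakNet.sendBlock A s) (p s)) →
      ∃ wS : Fin S → EuclideanSpace ℝ (Fin M),
        -- `wS s` is the unique minimizer of the aggregate cost, whatever the value of `μmax`
        (∀ μmax : ℝ, 0 < μmax → ∀ s v,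
          IsMinOn (WeakNet.aggregateCost J (WeakNet.stepSize τ μmax) s (p s)) Set.univ v ↔
            v = wS s) ∧
        -- mean-square stability for small step-sizes
        ∃ μ₀ : ℝ, 0 < μ₀ ∧ ∃ C : ℝ, ∀ μmax : ℝ, 0 < μmax → μmax < μ₀ →
          ∀ (Ω : Type*) [MeasurableSpace Ω] (P : MeasureTheory.Measure Ω)
            [MeasureTheory.IsProbabilityMeasure P]
            (w0 : WeakNet.Agent NS NR → Ω → EuclideanSpace ℝ (Fin M))
            (gHat : WeakNet.Agent NS NR → ℕ → EuclideanSpace ℝ (Fin M) → Ω →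
              EuclideanSpace ℝ (Fin M)),
            (∀ k, Measurable (w0 k) ∧ MeasureTheory.MemLp (w0 k) 2 P) →
            WeakNet.NoiseConditions P J gHat
              (WeakNet.iterate A (WeakNet.stepSize τ μmax) gHat w0) β σ →
            ∀ k, Filter.limsup (fun i : ℕ => ∫⁻ ω, ‖WeakNet.limitPoint A wS k -
                  WeakNet.iterate A (WeakNet.stepSize τ μmax) gHat w0 i k ω‖ₑ ^ 2 ∂P)
                Filter.atTop ≤ ENNReal.ofReal (C * μmax) := by
  refine ⟨hA.existsUnique_perron, hA.isUnit_one_sub_TRR, fun p hp => ?_⟩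
  obtain ⟨wS, a, ha, hmin, hzero, hmono⟩ := WeakNet.exists_pareto hJ_diff hJ_conv hJ_strong
    (fun k => (hτ k).1) (fun s k => (hp s).2.2 k)
  refine ⟨wS, fun μmax hμ s v => (WeakNet.isMinOn_aggregateCost_iff hμ s (p s) v).trans
    (hmin s v), ?_⟩
  have hLip : ∀ k x y, ‖gradient (J k) x - gradient (J k) y‖ ≤ |δ| * ‖x - y‖ := fun k =>
    WeakNet.norm_gradient_sub_le (hJ_diff2 k) fun v => (hJ_hess k v).trans (le_abs_self δ)
  have hgrow : ∀ k x, ‖gradient (J k) x‖ ≤ ‖gradient (J k) 0‖ + |δ| * ‖x‖ := by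
    intro k x
    have h := hLip k x 0
    rw [sub_zero] at h
    linarith [norm_le_norm_add_norm_sub' (gradient (J k) x) (gradient (J k) 0)]
  have hcont : ∀ k, Continuous (gradient (J k)) := fun k => (hJ_diff2 k).continuous
  obtain ⟨b, Kb, c, μ₁, r, K, hKb, hbup, hc, hblow, hμ₁, hr, hK, hdec⟩ :=
    hA.exists_lyapunov_meanStep hτ hp (abs_nonneg δ) hLip ha hzero hmono
  -- If `b x x < 0`, the lower bound forces `x = 0`, and then `b x x = 0`.
  have hb0 : ∀ x, 0 ≤ b x x := by
    intro x
    by_contra hneg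
    push Not at hneg
    have h1 := hblow x
    have h2 : ‖x‖ ^ 2 ≤ 0 := h1.trans (mul_nonpos_of_nonneg_of_nonpos hc hneg.le)
    have h3 : x = 0 := norm_eq_zero.1 (by nlinarith [norm_nonneg x])
    rw [h3] at hneg
    simp at hneg
  set wstar := WeakNet.spread A wS with hwstar
  set B : ℝ := ∑ k, (2 * β k ^ 2 * (1 + ‖wstar‖ ^ 2) + σ k ^ 2) with hB
  have hB0 : 0 ≤ B := Finset.sum_nonneg fun k _ => by positivity
  set L : ℝ := Kb * B * c with hL
  have hL0 : 0 ≤ L := by positivity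
  -- The second bound on the step-size absorbs the growth `L` of the noise, the third keeps the
  -- factor `1 - r * μmax / 2` nonnegative.
  refine ⟨min μ₁ (min (r / (2 * (L + 1))) (2 / r)), by positivity,
    c * ((K + Kb * B) * (2 / r)), ?_⟩
  intro μmax hμ hμlt Ω _ P _ w0 gHat hw0 hn k
  obtain ⟨hμlt1, hμlt⟩ := lt_min_iff.1 hμlt
  obtain ⟨hμlt2, hμlt3⟩ := lt_min_iff.1 hμlt
  rw [lt_div_iff₀ (by positivity)] at hμlt2 hμlt3
  have hstep : ∀ k, |WeakNet.stepSize τ μmax k| ≤ μmax := by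
    intro k
    rw [WeakNet.stepSize, abs_of_pos (mul_pos (hτ k).1 hμ)]
    exact mul_le_of_le_one_left hμ.le (hτ k).2
  set u : ℕ → ℝ := fun i => ∫ ω,
    b ((fun k => WeakNet.iterate A (WeakNet.stepSize τ μmax) gHat w0 i k ω) - wstar)
      ((fun k => WeakNet.iterate A (WeakNet.stepSize τ μmax) gHat w0 i k ω) - wstar) ∂P with hu
  have hu0 : ∀ i, 0 ≤ u i := fun i => MeasureTheory.integral_nonneg fun ω => hb0 _
  have hrec : ∀ i, u (i + 1) ≤ (1 - r * μmax / 2) * u i + (K + Kb * B) * μmax ^ 2 := by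
    intro i
    have h := WeakNet.integral_quadratic_succ_le hn hcont hgrow hw0 (hA.combine_spread wS)
      (WeakNet.norm_combine_le hA.nonneg hA.colSum) hstep hKb hbup (hdec μmax hμ hμlt1) hblow i
    -- The part of the noise that grows with the state takes away half of the decrease.
    have h2 : L * μmax ^ 2 * u i ≤ r * μmax / 2 * u i := by
      refine mul_le_mul_of_nonneg_right ?_ (hu0 i)
      nlinarith
    have h3 : u (i + 1) ≤ (1 - r * μmax) * u i + K * μmax ^ 2 +
        Kb * μmax ^ 2 * (B * (1 + c * u i)) := h
    rw [hL] at h2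
    linarith
  have hlim := WeakNet.limsup_le_of_recursion (r := r * μmax / 2) (by positivity) (by linarith) hc
    hrec fun i => WeakNet.lintegral_sq_error_le hn hcont hgrow hw0 hblow i k
  rw [WeakNet.limitPoint_eq_spread]
  refine hlim.trans_eq ?_
  congr 1
  field_simp
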